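/- For a partition $\pi$ with different parts $n_1<n_2<\cdots<n_m$, let $f_j=f_j(\pi)$ be the number of times the part $n_j$ occurs in $\pi$ ($1\le j\le m$). For $k\ge 1$ define the weight $$ \omega_k(\pi)=\sum_{\substack{m_1+m_2+\cdots+m_r=k\\ 1\le r\le k}}\binom{f_1+m_1-1}{2m_1-1}\sum_{2\le j_2<j_3<\cdots<j_r\le m}\binom{f_{j_2}+m_2}{2m_2}\binom{f_{j_3}+m_3}{2m_3}\cdots\binom{f_{j_r}+m_r}{2m_r}, $$ where the outer sum is over all compositions of $k$ into positive integers $m_1,\dots,m_r$ (for $r=1$ the inner sum is $1$), and for the empty partition put $\omega_k=0$. Define the higher order spt-function by $$ \operatorname{spt}_k(n)=\sum_{\pi\vdash n}\omega_k(\pi), $$ the sum being over all partitions $\pi$ of $n$. Then for every integer $n\ge 0$, $$ \operatorname{spt}_4(3n)\equiv 0\pmod 3. $$ -/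

import Mathlib

namespace HigherSpt

/-- The frequency `f_j(π)` of the `j`-th smallest of the different parts of the partition `π`.
The different parts are indexed from `0`, so `freq π 0` is the number of smallest parts. -/
def freq {n : ℕ} (π : n.Partition) (j : Fin π.parts.toFinset.card) : ℕ :=
  π.parts.count (π.parts.toFinset.orderEmbOfFin rfl j)

/-- The weight `ω_k(π)`, for `k ≥ 1`: the sum over all compositions `m_1 + ⋯ + m_r` of `k` and
all increasing tuples `j_1 < j_2 < ⋯ < j_r` of indices of different parts of `π`, where `j_1` is
the index of the smallest part, of
`C(f_{j_1} + m_1 - 1, 2 m_1 - 1) * C(f_{j_2} + m_2, 2 m_2) * ⋯ * C(f_{j_r} + m_r, 2 m_r)`. -/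
def weight (k : ℕ) {n : ℕ} (π : n.Partition) : ℕ :=
  ∑ m : Composition k,
    ∑ j : Fin m.length → Fin π.parts.toFinset.card with
        (∀ a b : Fin m.length, a < b → j a < j b) ∧ (∀ i : Fin m.length, (i : ℕ) = 0 → (j i : ℕ) = 0),
      ∏ i : Fin m.length,
        if (i : ℕ) = 0 then (freq π (j i) + m.blocksFun i - 1).choose (2 * m.blocksFun i - 1)
        else (freq π (j i) + m.blocksFun i).choose (2 * m.blocksFun i)

/-- The higher order spt-function `spt_k(n)`, for `k ≥ 1`: the sum of `ω_k(π)` over all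
partitions `π` of `n`. -/
def spt (k n : ℕ) : ℕ := ∑ π : n.Partition, weight k π

end HigherSpt

/-!
Fix `N`, let `x m = q ^ m / (1 - q ^ m) ^ 2` and `P = ∏ 1 / (1 - q ^ m)`, `1 ≤ m ≤ N`. Up to degree
`N`, the generating function of `spt (k + 1)` is `P * ∑ n, (q; q)_n * x n * h_k (x n, …, x N)`,
because `∑ c, C (c + m, 2 m) * q ^ (i c) = x i ^ m / (1 - q ^ i)`. For `k = 3` and over a domain of
characteristic three this series is a derivative for `q * d / dq`, and the coefficient of
`q ^ (3 n)` in such a derivative is divisible by `3`.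

The partial fraction expansion `∑ r j / (1 - u * x j)` of `∏ 1 / (1 - u * x m)` writes the sum in
terms of `h_4` and of cubic sums `∑ r j ^ 3 * f j`: up to degree `N` the squares of the residues are
explicit, since `r j` is essentially `± q ^ C (j, 2) * (1 + q ^ j)`. Cubing is additive, so cubic
sums are computed from the linear relations between the residues, which yields the part that is not
a polynomial in the nodes as a derivative of `P` times two further cubic sums. What remains is
symmetric in the nodes, and the derivatives of their elementary symmetric functions come from
Jacobi's triple product.
-/

namespace HigherSpt

open Finset PowerSeries

section Symmetric

variable {ι R : Type*} [CommRing R]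

lemma derivation_prod_eq_prod_mul_sum {A : Type*} [CommRing A] [Algebra R A] (D : Derivation R A A)
    {s : Finset ι} {f g : ι → A} (h : ∀ i ∈ s, D (f i) = f i * g i) :
    D (∏ i ∈ s, f i) = (∏ i ∈ s, f i) * ∑ i ∈ s, g i := by
  classical
  induction s using Finset.induction_on with
  | empty => simp
  | insert b s hb ih =>
    rw [prod_insert hb, sum_insert hb, Derivation.leibniz, ih fun i hi => h i (by simp [hi]),
      h b (by simp), smul_eq_mul, smul_eq_mul]
    ring

/-- The geometric series `∑ aⁿ Xⁿ = 1 / (1 - a X)`. -/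
def geom (a : R) : R⟦X⟧ := PowerSeries.mk fun n => a ^ n

@[simp] lemma coeff_geom (a : R) (n : ℕ) : coeff n (geom a) = a ^ n := coeff_mk _ _

lemma geom_mul_one_sub (a : R) : geom a * (1 - C a * X) = 1 := by
  ext n
  cases n with
  | zero => simp [geom]
  | succ n => simp [mul_sub, ← mul_assoc, coeff_succ_mul_X, coeff_one, pow_succ]

lemma map_geom {S : Type*} [CommRing S] (f : R →+* S) (a : R) :
    (geom a).map f = geom (f a) := by
  ext n
  simp

/-- The complete homogeneous symmetric function of degree `k` in the variables `x m`, `m ∈ s`,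
as a coefficient of its generating function. -/
noncomputable def hsymm (x : ι → R) (s : Finset ι) (k : ℕ) : R := coeff k (∏ m ∈ s, geom (x m))

/-- The elementary symmetric function of degree `k` in the variables `x m`, `m ∈ s`, times
`(-1) ^ k`: with this sign it is a coefficient of `∏ (1 - x m X)`, the inverse of the generating
function of `hsymm`. -/
noncomputable def signedEsymm (x : ι → R) (s : Finset ι) (k : ℕ) : R :=
  coeff k (∏ m ∈ s, (1 - C (x m) * X))

/-- The power sum of degree `k` in the variables `x m`, `m ∈ s`. -/
def psum (x : ι → R) (s : Finset ι) (k : ℕ) : R := ∑ m ∈ s, x m ^ k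

variable (x : ι → R) (s : Finset ι)

lemma prod_geom_mul_prod_one_sub :
    (∏ m ∈ s, geom (x m)) * ∏ m ∈ s, (1 - C (x m) * X) = 1 := by
  rw [← prod_mul_distrib]
  exact prod_eq_one fun m _ => geom_mul_one_sub _

lemma map_hsymm {S : Type*} [CommRing S] (f : R →+* S) (k : ℕ) :
    f (hsymm x s k) = hsymm (fun i => f (x i)) s k := by
  simp only [hsymm, ← map_geom, ← map_prod, PowerSeries.coeff_map]

lemma hsymm_zero : hsymm x s 0 = 1 := by
  simp [hsymm, coeff_zero_eq_constantCoeff, map_prod, geom, constantCoeff_mk]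

lemma signedEsymm_zero : signedEsymm x s 0 = 1 := by
  simp [signedEsymm, coeff_zero_eq_constantCoeff, map_prod]

lemma derivative_geom (a : R) :
    derivative R (geom a) = geom a * PowerSeries.mk fun n => a ^ (n + 1) := by
  ext n
  rw [coeff_derivative, coeff_mul, sum_congr rfl (g := fun _ => a ^ (n + 1))]
  · simp [mul_comm]
  · intro p hp
    rw [coeff_geom, coeff_mk, ← pow_add, ← add_assoc, mem_antidiagonal.1 hp]

lemma derivative_prod_geom : derivative R (∏ m ∈ s, geom (x m)) =
    (∏ m ∈ s, geom (x m)) * PowerSeries.mk fun n => psum x s (n + 1) := by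
  rw [derivation_prod_eq_prod_mul_sum _ fun m _ => derivative_geom (x m)]
  congr 1
  ext n
  simp [psum]

lemma sum_antidiagonal_hsymm_mul_psum (n : ℕ) :
    ∑ p ∈ antidiagonal n, hsymm x s p.1 * psum x s (p.2 + 1) = (n + 1) * hsymm x s (n + 1) := by
  have h := congrArg (coeff n) (derivative_prod_geom x s)
  rw [coeff_derivative, coeff_mul, mul_comm] at h
  simpa only [coeff_mk, hsymm] using h.symm

lemma sum_antidiagonal_hsymm_mul_signedEsymm (n : ℕ) :
    ∑ p ∈ antidiagonal (n + 1), hsymm x s p.1 * signedEsymm x s p.2 = 0 := by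
  have h := congrArg (coeff (n + 1)) (prod_geom_mul_prod_one_sub x s)
  rw [coeff_mul, coeff_one, if_neg n.succ_ne_zero] at h
  exact h

lemma hsymm_one : hsymm x s 1 = psum x s 1 := by
  simpa [hsymm_zero] using (sum_antidiagonal_hsymm_mul_psum x s 0).symm

lemma signedEsymm_one : signedEsymm x s 1 = -psum x s 1 := by
  have h := sum_antidiagonal_hsymm_mul_signedEsymm x s 0
  simp only [Nat.sum_antidiagonal_succ, Nat.antidiagonal_zero, sum_singleton, zero_add, hsymm_zero,
    signedEsymm_zero, hsymm_one] at h
  linear_combination h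

lemma hsymm_two : hsymm x s 2 = psum x s 1 ^ 2 - signedEsymm x s 2 := by
  have h := sum_antidiagonal_hsymm_mul_signedEsymm x s 1
  simp only [Nat.sum_antidiagonal_succ, Nat.antidiagonal_zero, sum_singleton, zero_add, hsymm_zero,
    signedEsymm_zero, hsymm_one, signedEsymm_one, Nat.reduceAdd] at h
  linear_combination h

lemma hsymm_three : hsymm x s 3 =
    psum x s 1 ^ 3 - 2 * psum x s 1 * signedEsymm x s 2 - signedEsymm x s 3 := by
  have h := sum_antidiagonal_hsymm_mul_signedEsymm x s 2
  simp only [Nat.sum_antidiagonal_succ, Nat.antidiagonal_zero, sum_singleton, zero_add, hsymm_zero,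
    signedEsymm_zero, hsymm_one, signedEsymm_one, Nat.reduceAdd, hsymm_two] at h
  linear_combination h

lemma psum_two : psum x s 2 = psum x s 1 ^ 2 - 2 * signedEsymm x s 2 := by
  have h := sum_antidiagonal_hsymm_mul_psum x s 1
  simp only [Nat.sum_antidiagonal_succ, Nat.antidiagonal_zero, sum_singleton, zero_add, hsymm_zero,
    hsymm_one, Nat.reduceAdd, hsymm_two, Nat.cast_one] at h
  linear_combination h

lemma four_mul_hsymm_four : 4 * hsymm x s 4 = psum x s 4 + psum x s 1 * psum x s 3 +
    hsymm x s 2 * psum x s 2 + hsymm x s 3 * psum x s 1 := by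
  have h := sum_antidiagonal_hsymm_mul_psum x s 3
  simp only [Nat.sum_antidiagonal_succ, Nat.antidiagonal_zero, sum_singleton, zero_add, hsymm_zero,
    hsymm_one, Nat.reduceAdd, Nat.cast_ofNat] at h
  linear_combination -h

end Symmetric

section PartialFractions

variable {ι L : Type*} [DecidableEq ι] [Field L]

/-- The residue at `u = 1 / x j` in the partial fraction expansion of `∏ m ∈ s, 1 / (1 - u x m)`,
normalised so that the expansion is `∑ j ∈ s, residue x s j / (1 - u x j)`. -/
def residue (x : ι → L) (s : Finset ι) (j : ι) : L := ∏ m ∈ s.erase j, x j / (x j - x m)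

variable {x : ι → L} {s : Finset ι}

lemma lagrange_basisDivisor_inv {a b : L} (ha : a ≠ 0) (hb : b ≠ 0) :
    Lagrange.basisDivisor a⁻¹ b⁻¹ =
      Polynomial.C (a / (a - b)) * (1 - Polynomial.C b * Polynomial.X) := by
  have hab : (a⁻¹ - b⁻¹)⁻¹ = -(a / (a - b) * b) := by
    rw [inv_sub_inv ha hb, inv_div, ← neg_sub a b, div_neg, mul_div_right_comm]
  have hC : Polynomial.C b⁻¹ * Polynomial.C b = 1 := by
    rw [← map_mul, inv_mul_cancel₀ hb, map_one]
  rw [Lagrange.basisDivisor, hab, map_neg, map_mul]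
  linear_combination Polynomial.C (a / (a - b)) * hC

lemma lagrange_basis_inv (hx0 : ∀ m ∈ s, x m ≠ 0) {j : ι} (hj : j ∈ s) :
    Lagrange.basis s (fun m => (x m)⁻¹) j = Polynomial.C (residue x s j) *
      ∏ m ∈ s.erase j, (1 - Polynomial.C (x m) * Polynomial.X) := by
  rw [Lagrange.basis, residue, map_prod, ← prod_mul_distrib]
  exact prod_congr rfl fun m hm =>
    lagrange_basisDivisor_inv (hx0 j hj) (hx0 m (mem_of_mem_erase hm))

-- Partial fractions with cleared denominators are Lagrange interpolation of `1` at the `1 / x m`.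
lemma sum_residue_mul_prod_erase (hs : s.Nonempty) (hx : Set.InjOn x s)
    (hx0 : ∀ m ∈ s, x m ≠ 0) :
    ∑ j ∈ s, Polynomial.C (residue x s j) *
      ∏ m ∈ s.erase j, (1 - Polynomial.C (x m) * Polynomial.X) = 1 := by
  have hinv : Set.InjOn (fun m => (x m)⁻¹) s := fun a ha b hb h => hx ha hb (inv_injective h)
  exact (sum_congr rfl fun j hj => (lagrange_basis_inv hx0 hj).symm).trans
    (Lagrange.sum_basis hinv hs)

lemma prod_geom_eq_sum_residue (hs : s.Nonempty) (hx : Set.InjOn x s)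
    (hx0 : ∀ m ∈ s, x m ≠ 0) :
    ∏ m ∈ s, geom (x m) = ∑ j ∈ s, C (residue x s j) * geom (x j) := by
  have h := congrArg (Polynomial.coeToPowerSeries.ringHom (R := L))
    (sum_residue_mul_prod_erase hs hx hx0)
  simp only [map_sum, map_mul, map_prod, map_sub, map_one,
    Polynomial.coeToPowerSeries.ringHom_apply, Polynomial.coe_C, Polynomial.coe_X] at h
  rw [← mul_one (∏ m ∈ s, geom (x m)), ← h, mul_sum]
  refine sum_congr rfl fun j hj => ?_
  rw [← mul_prod_erase s _ hj]
  linear_combination C (residue x s j) * geom (x j) * prod_geom_mul_prod_one_sub x (s.erase j)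

lemma hsymm_eq_sum_residue (hs : s.Nonempty) (hx : Set.InjOn x s) (hx0 : ∀ m ∈ s, x m ≠ 0)
    (k : ℕ) : hsymm x s k = ∑ j ∈ s, residue x s j * x j ^ k := by
  rw [hsymm, prod_geom_eq_sum_residue hs hx hx0, map_sum]
  simp only [coeff_C_mul, coeff_geom]

lemma sub_ne_zero_of_mem_erase (hx : Set.InjOn x s) {a m : ι} (ha : a ∈ s) (hm : m ∈ s.erase a) :
    x a - x m ≠ 0 :=
  sub_ne_zero.2 fun h => ne_of_mem_erase hm (hx ha (mem_of_mem_erase hm) h).symm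

lemma residue_mul_prod_one_sub (hx : Set.InjOn x s) (hx0 : ∀ m ∈ s, x m ≠ 0) {a : ι}
    (ha : a ∈ s) : residue x s a * ∏ m ∈ s.erase a, (1 - x m * (x a)⁻¹) = 1 := by
  rw [residue, ← prod_mul_distrib]
  refine prod_eq_one fun m hm => ?_
  have hsub := sub_ne_zero_of_mem_erase hx ha hm
  have hxa := hx0 a ha
  field_simp

lemma eval_derivative_prod_one_sub (x : ι → L) (s : Finset ι) (u : L) :
    (Polynomial.derivative (∏ m ∈ s, (1 - Polynomial.C (x m) * Polynomial.X))).eval u =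
      -∑ m ∈ s, x m * ∏ l ∈ s.erase m, (1 - x l * u) := by
  rw [Polynomial.derivative_prod_finset, Polynomial.eval_finsetSum, ← sum_neg_distrib]
  refine sum_congr rfl fun m _ => ?_
  rw [Polynomial.eval_mul, Polynomial.eval_prod, mul_comm, ← neg_mul]
  simp

lemma eval_derivative_prod_erase_self (hx0 : ∀ m ∈ s, x m ≠ 0) (hx : Set.InjOn x s) {a : ι}
    (ha : a ∈ s) :
    (Polynomial.derivative
        (∏ m ∈ s.erase a, (1 - Polynomial.C (x m) * Polynomial.X))).eval (x a)⁻¹ =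
      -((∏ m ∈ s.erase a, (1 - x m * (x a)⁻¹)) * (x a * ∑ m ∈ s.erase a, x m / (x a - x m))) := by
  rw [eval_derivative_prod_one_sub, mul_sum, mul_sum]
  refine congrArg _ (sum_congr rfl fun m hm => ?_)
  have hsub := sub_ne_zero_of_mem_erase hx ha hm
  have hxa := hx0 a ha
  rw [← mul_prod_erase _ _ hm]
  field_simp

-- Only the derivative of the factor that vanishes at `1 / x a` contributes.
lemma eval_derivative_prod_erase_of_ne (hx0 : ∀ m ∈ s, x m ≠ 0) (hx : Set.InjOn x s) {a m : ι}
    (ha : a ∈ s) (hm : m ∈ s.erase a) :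
    (Polynomial.derivative
        (∏ l ∈ s.erase m, (1 - Polynomial.C (x l) * Polynomial.X))).eval (x a)⁻¹ =
      (∏ l ∈ s.erase a, (1 - x l * (x a)⁻¹)) * (x a * (x a / (x m - x a))) := by
  have hsub := sub_ne_zero_of_mem_erase hx ha hm
  have hxa := hx0 a ha
  have ham : a ∈ s.erase m := mem_erase.2 ⟨(ne_of_mem_erase hm).symm, ha⟩
  rw [eval_derivative_prod_one_sub, sum_eq_single_of_mem a ham, erase_right_comm,
    ← mul_prod_erase _ _ hm, ← neg_sub (x a) (x m), div_neg]
  · field_simp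
  · intro l _ hla
    rw [prod_eq_zero (mem_erase.2 ⟨hla.symm, ham⟩) (by rw [mul_inv_cancel₀ hxa, sub_self]),
      mul_zero]

lemma sum_residue_reciprocity (hx : Set.InjOn x s) (hx0 : ∀ m ∈ s, x m ≠ 0) {a : ι}
    (ha : a ∈ s) :
    ∑ m ∈ s.erase a, residue x s m * (x a / (x m - x a)) =
      residue x s a * ∑ m ∈ s.erase a, x m / (x a - x m) := by
  have hP := right_ne_zero_of_mul_eq_one (residue_mul_prod_one_sub hx hx0 ha)
  have h := congrArg (fun p => (Polynomial.derivative p).eval (x a)⁻¹)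
    (sum_residue_mul_prod_erase ⟨a, ha⟩ hx hx0)
  simp only [Polynomial.derivative_sum, Polynomial.derivative_C_mul, Polynomial.eval_finsetSum,
    Polynomial.eval_mul, Polynomial.eval_C, Polynomial.derivative_one, Polynomial.eval_zero] at h
  rw [← add_sum_erase s _ ha, eval_derivative_prod_erase_self hx0 hx ha] at h
  have hne := sum_congr rfl fun m hm => congrArg (residue x s m * ·)
    (eval_derivative_prod_erase_of_ne hx0 hx ha hm)
  simp only [mul_left_comm (residue x s _), ← mul_sum] at hne
  rw [hne] at h
  refine mul_left_cancel₀ (mul_ne_zero hP (hx0 a ha)) ?_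
  linear_combination h

end PartialFractions

section NodeRatios

variable {ι A : Type*} [DecidableEq ι] [CommRing A]

/-- The elements `x m`, `m ∈ s`, are distinct nonzero nodes and `y j m` is `x m / (x j - x m)`.
Stated without division, so that it makes sense for nodes in a domain such as a power series ring;
that the nodes are distinct is a consequence. -/
structure NodeRatios (x : ι → A) (y : ι → ι → A) (s : Finset ι) : Prop where
  ne_zero : ∀ m ∈ s, x m ≠ 0
  ratio_mul_sub : ∀ j ∈ s, ∀ m ∈ s.erase j, y j m * (x j - x m) = x m

/-- The residue `∏ x j / (x j - x m)`, in terms of the ratios `y j m = x m / (x j - x m)`. -/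
def ratioResidue (y : ι → ι → A) (s : Finset ι) (j : ι) : A := ∏ m ∈ s.erase j, (1 + y j m)

namespace NodeRatios

variable {x : ι → A} {y : ι → ι → A} {s : Finset ι}

lemma injOn (h : NodeRatios x y s) : Set.InjOn x s := by
  intro a ha b hb hab
  by_contra hne
  apply h.ne_zero b hb
  rw [← h.ratio_mul_sub a ha b (mem_erase.2 ⟨Ne.symm hne, hb⟩), hab, sub_self, mul_zero]

lemma map {B : Type*} [CommRing B] {f : A →+* B} (hf : Function.Injective f)
    (h : NodeRatios x y s) :
    NodeRatios (fun m => f (x m)) (fun j m => f (y j m)) s where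
  ne_zero m hm := (map_ne_zero_iff f hf).2 (h.ne_zero m hm)
  ratio_mul_sub j hj m hm := by simp only [← map_sub, ← map_mul, h.ratio_mul_sub j hj m hm]

section Field

variable {L : Type*} [Field L] {x : ι → L} {y : ι → ι → L}

lemma eq_div (h : NodeRatios x y s) {j m : ι} (hj : j ∈ s) (hm : m ∈ s.erase j) :
    y j m = x m / (x j - x m) :=
  eq_div_of_mul_eq (sub_ne_zero_of_mem_erase h.injOn hj hm) (h.ratio_mul_sub j hj m hm)

lemma ratioResidue_eq (h : NodeRatios x y s) {j : ι} (hj : j ∈ s) :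
    ratioResidue y s j = residue x s j := by
  refine prod_congr rfl fun m hm => ?_
  rw [h.eq_div hj hm, one_add_div (sub_ne_zero_of_mem_erase h.injOn hj hm), sub_add_cancel]

end Field

section CharThree

variable [CharP A 3]

lemma sq_mul_ratio_sq (h : NodeRatios x y s) {j m : ι} (hj : j ∈ s) (hm : m ∈ s.erase j) :
    x j ^ 2 * y j m ^ 2 = x m ^ 2 - y j m ^ 3 * (x j ^ 2 - x m ^ 2) := by
  have hxm := h.ratio_mul_sub j hj m hm
  have hxj : x j = (1 + y j m) * (x j - x m) := by rw [add_mul, hxm, one_mul, sub_add_cancel]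
  have h3 : (3 : A) = 0 := CharP.ofNat_eq_zero A 3
  generalize x j - x m = d at hxm hxj
  rw [hxj, ← hxm]
  linear_combination (y j m ^ 3 * d ^ 2 + y j m ^ 4 * d ^ 2) * h3

lemma pow_four_mul_ratio_sub_sq (h : NodeRatios x y s) {j m : ι} (hj : j ∈ s)
    (hm : m ∈ s.erase j) : x j ^ 4 * (y j m - y j m ^ 2) =
      x m ^ 4 + x j ^ 3 * x m - y j m ^ 3 * (x j ^ 4 - x m ^ 4) := by
  have hxm := h.ratio_mul_sub j hj m hm
  have hxj : x j = (1 + y j m) * (x j - x m) := by rw [add_mul, hxm, one_mul, sub_add_cancel]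
  have h3 : (3 : A) = 0 := CharP.ofNat_eq_zero A 3
  generalize x j - x m = d at hxm hxj
  rw [hxj, ← hxm]
  linear_combination (y j m ^ 5 * d ^ 4 + y j m ^ 6 * d ^ 4) * h3

end CharThree

variable [IsDomain A]

lemma algebraMap_ratioResidue (h : NodeRatios x y s) {j : ι} (hj : j ∈ s) :
    algebraMap A (FractionRing A) (ratioResidue y s j) =
      residue (fun m => algebraMap A (FractionRing A) (x m)) s j := by
  rw [← (h.map (IsFractionRing.injective A (FractionRing A))).ratioResidue_eq hj]
  simp only [ratioResidue, map_prod, map_add, map_one]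

lemma sum_ratioResidue_mul_pow (h : NodeRatios x y s) (hs : s.Nonempty) (k : ℕ) :
    ∑ j ∈ s, ratioResidue y s j * x j ^ k = hsymm x s k := by
  have hL := h.map (IsFractionRing.injective A (FractionRing A))
  apply IsFractionRing.injective A (FractionRing A)
  rw [map_hsymm, hsymm_eq_sum_residue hs hL.injOn hL.ne_zero, map_sum]
  exact sum_congr rfl fun j hj => by rw [map_mul, map_pow, h.algebraMap_ratioResidue hj]

lemma sum_ratioResidue_reciprocity (h : NodeRatios x y s) {a : ι} (ha : a ∈ s) :
    ∑ m ∈ s.erase a, ratioResidue y s m * y m a =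
      ratioResidue y s a * ∑ m ∈ s.erase a, y a m := by
  have hL := h.map (IsFractionRing.injective A (FractionRing A))
  apply IsFractionRing.injective A (FractionRing A)
  rw [map_mul, map_sum, map_sum, h.algebraMap_ratioResidue ha]
  convert! sum_residue_reciprocity hL.injOn hL.ne_zero ha using 1
  · refine sum_congr rfl fun m hm => ?_
    have hms := mem_of_mem_erase hm
    rw [map_mul, h.algebraMap_ratioResidue hms,
      hL.eq_div hms (mem_erase.2 ⟨(ne_of_mem_erase hm).symm, ha⟩)]
  · exact congrArg _ (sum_congr rfl fun m hm => hL.eq_div ha hm)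

variable [CharP A 3]

lemma sum_ratioResidue_cube (h : NodeRatios x y s) (hs : s.Nonempty) :
    ∑ j ∈ s, ratioResidue y s j ^ 3 = 1 := by
  have h0 := congrArg (· ^ 3) (h.sum_ratioResidue_mul_pow hs 0)
  simpa only [sum_pow_char 3, pow_zero, mul_one, hsymm_zero, one_pow] using h0

lemma sum_ratioResidue_cube_mul_cube (h : NodeRatios x y s) (hs : s.Nonempty) :
    ∑ j ∈ s, ratioResidue y s j ^ 3 * x j ^ 3 = psum x s 1 ^ 3 := by
  have h1 := congrArg (· ^ 3) (h.sum_ratioResidue_mul_pow hs 1)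
  simpa only [sum_pow_char 3, mul_pow, pow_one, hsymm_one] using h1

-- The cube of the reciprocity law makes the double sum antisymmetric.
lemma sum_ratioResidue_cube_mul_sum_sub (h : NodeRatios x y s) (f : ι → A) :
    ∑ j ∈ s, ratioResidue y s j ^ 3 * ∑ m ∈ s.erase j, y j m ^ 3 * (f j - f m) = 0 := by
  simp only [mul_sum, mul_sub, sum_sub_distrib]
  rw [sub_eq_zero, eq_comm, sum_comm' (t' := s) (s' := fun m => s.erase m)]
  · refine sum_congr rfl fun a ha => ?_
    have hrec := congrArg (· ^ 3) (h.sum_ratioResidue_reciprocity ha)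
    simp only [mul_pow, sum_pow_char 3] at hrec
    simp only [← mul_assoc, ← sum_mul, ← mul_sum, hrec]
  · intro a b
    simp only [mem_erase]
    tauto

lemma sum_ratioResidue_cube_mul_sq (h : NodeRatios x y s) (hs : s.Nonempty) :
    ∑ j ∈ s, ratioResidue y s j ^ 3 * (x j ^ 2 * (1 + ∑ m ∈ s.erase j, y j m ^ 2)) =
      psum x s 2 := by
  have hterm : ∀ j ∈ s, x j ^ 2 * (1 + ∑ m ∈ s.erase j, y j m ^ 2) =
      psum x s 2 - ∑ m ∈ s.erase j, y j m ^ 3 * (x j ^ 2 - x m ^ 2) := by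
    intro j hj
    rw [mul_add, mul_sum, sum_congr rfl fun m hm => h.sq_mul_ratio_sq hj hm, sum_sub_distrib, psum,
      ← add_sum_erase s _ hj]
    ring
  rw [sum_congr rfl fun j hj => by rw [hterm j hj, mul_sub], sum_sub_distrib,
    h.sum_ratioResidue_cube_mul_sum_sub fun j => x j ^ 2, ← sum_mul, h.sum_ratioResidue_cube hs,
    one_mul, sub_zero]

lemma sum_ratioResidue_cube_mul_pow_four (h : NodeRatios x y s) (hs : s.Nonempty) :
    ∑ j ∈ s, ratioResidue y s j ^ 3 * (x j ^ 4 * (∑ m ∈ s.erase j, (y j m - y j m ^ 2) - 1)) =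
      psum x s 4 + psum x s 1 ^ 4 := by
  have h3 : (3 : A) = 0 := CharP.ofNat_eq_zero A 3
  have hterm : ∀ j ∈ s, x j ^ 4 * (∑ m ∈ s.erase j, (y j m - y j m ^ 2) - 1) =
      psum x s 4 + x j ^ 3 * psum x s 1 -
        ∑ m ∈ s.erase j, y j m ^ 3 * (x j ^ 4 - x m ^ 4) := by
    intro j hj
    rw [mul_sub, mul_sum, sum_congr rfl fun m hm => h.pow_four_mul_ratio_sub_sq hj hm,
      sum_sub_distrib, sum_add_distrib, ← mul_sum, psum, psum, ← add_sum_erase s _ hj,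
      ← add_sum_erase s (fun m => x m ^ 1) hj]
    simp only [pow_one]
    linear_combination -x j ^ 4 * h3
  rw [sum_congr rfl fun j hj => by rw [hterm j hj, mul_sub, mul_add, ← mul_assoc],
    sum_sub_distrib, sum_add_distrib, h.sum_ratioResidue_cube_mul_sum_sub fun j => x j ^ 4,
    ← sum_mul, ← sum_mul, h.sum_ratioResidue_cube hs, h.sum_ratioResidue_cube_mul_cube hs]
  ring

end NodeRatios

end NodeRatios

section QBinomial

variable {R : Type*} [CommRing R]

/-- The `q`-shifted factorial `(a; q)_n = (1 - a) (1 - a q) ⋯ (1 - a q ^ (n - 1))`. -/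
def qPoch (q a : R) (n : ℕ) : R := ∏ i ∈ range n, (1 - a * q ^ i)

lemma qPoch_zero (q a : R) : qPoch q a 0 = 1 := prod_range_zero _

lemma qPoch_succ (q a : R) (n : ℕ) : qPoch q a (n + 1) = qPoch q a n * (1 - a * q ^ n) :=
  prod_range_succ _ _

lemma qPoch_succ' (q a : R) (n : ℕ) : qPoch q a (n + 1) = (1 - a) * qPoch q (a * q) n := by
  simp only [qPoch, prod_range_succ', pow_zero, mul_one, mul_comm _ (1 - a), pow_succ',
    mul_assoc]

lemma qPoch_self_succ (q : R) (n : ℕ) : qPoch q q (n + 1) = qPoch q q n * (1 - q ^ (n + 1)) := by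
  rw [qPoch_succ, pow_succ']

lemma qPoch_self_eq_prod_Icc (q : R) (n : ℕ) : qPoch q q n = ∏ m ∈ Icc 1 n, (1 - q ^ m) := by
  induction n with
  | zero => simp [qPoch_zero]
  | succ n ih => rw [prod_Icc_succ_top (by omega), qPoch_self_succ, ih]

lemma map_qPoch {S : Type*} [CommRing S] (f : R →+* S) (q a : R) (n : ℕ) :
    f (qPoch q a n) = qPoch (f q) (f a) n := by
  simp only [qPoch, map_prod, map_sub, map_one, map_mul, map_pow]

/-- The Gaussian binomial coefficient, defined by its Pascal recursion so that it makes sense for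
every `q`; it vanishes for `n < k`. -/
def qBinom (q : R) : ℕ → ℕ → R
  | _, 0 => 1
  | 0, _ + 1 => 0
  | n + 1, k + 1 => qBinom q n k + q ^ (k + 1) * qBinom q n (k + 1)

@[simp]
lemma qBinom_zero_right (q : R) (n : ℕ) : qBinom q n 0 = 1 := by
  cases n <;> rfl

lemma qBinom_succ_succ (q : R) (n k : ℕ) :
    qBinom q (n + 1) (k + 1) = qBinom q n k + q ^ (k + 1) * qBinom q n (k + 1) := rfl

lemma qBinom_eq_zero_of_lt (q : R) {n k : ℕ} (h : n < k) : qBinom q n k = 0 := by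
  induction n generalizing k with
  | zero => obtain ⟨k, rfl⟩ := Nat.exists_eq_succ_of_ne_zero h.ne'; rfl
  | succ n ih =>
    obtain ⟨k, rfl⟩ := Nat.exists_eq_succ_of_ne_zero (Nat.ne_zero_of_lt h)
    rw [Nat.succ_eq_add_one, qBinom_succ_succ, ih (by omega), ih (by omega), mul_zero, add_zero]

lemma qBinom_self (q : R) (n : ℕ) : qBinom q n n = 1 := by
  induction n with
  | zero => rfl
  | succ n ih => rw [qBinom_succ_succ, ih, qBinom_eq_zero_of_lt q n.lt_succ_self, mul_zero,
      add_zero]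

lemma one_sub_pow_succ_mul_qBinom_succ (q : R) (k l : ℕ) :
    (1 - q ^ (k + 1)) * qBinom q (k + l) (k + 1) = (1 - q ^ l) * qBinom q (k + l) k := by
  induction hn : k + l generalizing k l with
  | zero =>
    obtain ⟨rfl, rfl⟩ : k = 0 ∧ l = 0 := by omega
    rw [qBinom_eq_zero_of_lt q (by omega)]
    ring
  | succ n ih =>
    rcases l with - | l
    · rw [qBinom_eq_zero_of_lt q (by omega), pow_zero, sub_self, mul_zero, zero_mul]
    rcases k with - | k
    · obtain rfl : l = n := by omega
      have h := ih 0 l (zero_add l)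
      simp only [qBinom_succ_succ, qBinom_zero_right] at h ⊢
      linear_combination q * h
    · have h := ih (k + 1) l (by omega)
      have h' := ih k (l + 1) (by omega)
      simp only [qBinom_succ_succ]
      linear_combination q ^ (k + 2) * h + h'

lemma qBinom_succ_succ' (q : R) (k l : ℕ) :
    qBinom q (k + l + 1) (k + 1) = q ^ l * qBinom q (k + l) k + qBinom q (k + l) (k + 1) := by
  rw [qBinom_succ_succ]
  linear_combination -one_sub_pow_succ_mul_qBinom_succ q k l

lemma qBinom_symm (q : R) (k l : ℕ) : qBinom q (k + l) k = qBinom q (k + l) l := by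
  induction hn : k + l generalizing k l with
  | zero => rw [(by omega : k = 0), (by omega : l = 0)]
  | succ n ih =>
    rcases k with - | k
    · rw [(by omega : l = n + 1), qBinom_self, qBinom_zero_right]
    rcases l with - | l
    · rw [(by omega : k = n), qBinom_self, qBinom_zero_right]
    obtain rfl : n = k + (l + 1) := by omega
    have h := qBinom_succ_succ' q k (l + 1)
    rw [h, qBinom_succ_succ, ih k (l + 1) rfl, ih (k + 1) l (by omega), add_comm]

lemma qBinom_mul_qPoch_mul_qPoch (q : R) (k l : ℕ) :
    qBinom q (k + l) k * qPoch q q k * qPoch q q l = qPoch q q (k + l) := by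
  induction k generalizing l with
  | zero => simp [qPoch_zero]
  | succ k ih =>
    have h := one_sub_pow_succ_mul_qBinom_succ q k (l + 1)
    have h' := ih (l + 1)
    rw [← add_assoc, qPoch_self_succ q l] at h'
    rw [← add_assoc] at h
    rw [add_right_comm, ← h', qPoch_self_succ]
    linear_combination qPoch q q k * qPoch q q l * h

lemma qBinom_add_two (q : R) {m k : ℕ} (h : k ≤ m) :
    qBinom q (m + 2) (k + 2) = (1 + q ^ (m + 1)) * qBinom q m (k + 1) +
      q ^ (m - k) * qBinom q m k + q ^ (k + 2) * qBinom q m (k + 2) := by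
  obtain ⟨l, rfl⟩ := Nat.exists_eq_add_of_le h
  rw [qBinom_succ_succ, qBinom_succ_succ', Nat.add_sub_cancel_left]
  rcases l with - | l
  · simp [qBinom_eq_zero_of_lt]
  · rw [show k + (l + 1) = k + 1 + l by omega, qBinom_succ_succ']
    ring

end QBinomial

section Theta

/-- The coefficient of `u ^ k` in the polynomial `θ_n(u)` with
`θ_n(z + z⁻¹ - 2) = z ^ n + z ^ (n - 1) + ⋯ + z ^ (-n)`, the coefficients of Jacobi's triple
product in the variable `u`. -/
def thetaCoeff (n k : ℕ) : ℕ := (n + k + 1).choose (2 * k + 1) + (n + k).choose (2 * k + 1)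

lemma choose_add_two_add_choose (a b : ℕ) :
    (a + 2).choose (b + 2) + a.choose (b + 2) = a.choose b + 2 * (a + 1).choose (b + 2) := by
  simp only [Nat.choose_succ_succ' (a + 1), Nat.choose_succ_succ' a]
  ring

lemma thetaCoeff_zero_left (k : ℕ) : thetaCoeff 0 k = if k = 0 then 1 else 0 := by
  rcases k with - | k
  · rfl
  · rw [if_neg k.succ_ne_zero, thetaCoeff, Nat.choose_eq_zero_of_lt (by omega),
      Nat.choose_eq_zero_of_lt (by omega)]

lemma thetaCoeff_one_left (k : ℕ) :
    thetaCoeff 1 k = if k = 0 then 3 else if k = 1 then 1 else 0 := by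
  rcases k with - | - | k
  · rfl
  · rfl
  · rw [if_neg (by omega), if_neg (by omega), thetaCoeff, Nat.choose_eq_zero_of_lt (by omega),
      Nat.choose_eq_zero_of_lt (by omega)]

lemma thetaCoeff_add_two_zero (n : ℕ) :
    thetaCoeff (n + 2) 0 + thetaCoeff n 0 = 2 * thetaCoeff (n + 1) 0 := by
  simp only [thetaCoeff, mul_zero, zero_add, Nat.choose_one_right]
  ring

lemma thetaCoeff_add_two_succ (n k : ℕ) :
    thetaCoeff (n + 2) (k + 1) + thetaCoeff n (k + 1) =
      thetaCoeff (n + 1) k + 2 * thetaCoeff (n + 1) (k + 1) := by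
  have h := choose_add_two_add_choose (n + k + 2) (2 * k + 1)
  have h' := choose_add_two_add_choose (n + k + 1) (2 * k + 1)
  simp only [thetaCoeff]
  ring_nf at h h' ⊢
  omega

lemma mul_thetaCoeff (n k : ℕ) :
    (2 * k + 1) * thetaCoeff n k = (2 * n + 1) * (n + k).choose (2 * k) := by
  rcases lt_or_ge n k with h | h
  · rw [thetaCoeff, Nat.choose_eq_zero_of_lt (by omega), Nat.choose_eq_zero_of_lt (by omega),
      Nat.choose_eq_zero_of_lt (by omega)]
    ring
  obtain ⟨d, rfl⟩ := Nat.exists_eq_add_of_le h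
  have h1 := Nat.add_one_mul_choose_eq (k + d + k) (2 * k)
  have h2 := Nat.choose_succ_right_eq (k + d + k) (2 * k)
  rw [show k + d + k - 2 * k = d by omega] at h2
  simp only [thetaCoeff]
  linarith

lemma choose_mul_add_choose_mul (n k : ℕ) :
    (n + k + 1).choose (2 * k + 2) * ((2 * k + 2) * (2 * k + 1)) +
      k * (k + 1) * (n + k).choose (2 * k) = n * (n + 1) * (n + k).choose (2 * k) := by
  rcases lt_or_ge n k with h | h
  · simp only [Nat.choose_eq_zero_of_lt (by omega : n + k + 1 < 2 * k + 2),
      Nat.choose_eq_zero_of_lt (by omega : n + k < 2 * k), mul_zero, zero_mul, add_zero]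
  obtain ⟨d, rfl⟩ := Nat.exists_eq_add_of_le h
  have h1 := Nat.add_one_mul_choose_eq (k + d + k) (2 * k + 1)
  have h2 := Nat.choose_succ_right_eq (k + d + k) (2 * k)
  rw [show k + d + k - 2 * k = d by omega] at h2
  zify at *
  linear_combination (k + d + k + 1) * h2 - (2 * k + 1) * h1

/-- `θ_n` is an eigenfunction of a second order differential operator in `u`, with the triangular
number of `n` as eigenvalue; this is its coefficient form. -/
lemma thetaCoeff_succ (n k : ℕ) :
    (k + 1) * (2 * k + 3) * thetaCoeff n (k + 1) + (k + 1).choose 2 * thetaCoeff n k =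
      (n + 1).choose 2 * thetaCoeff n k := by
  have hn := Nat.add_one_mul_choose_eq n 1
  have hk := Nat.add_one_mul_choose_eq k 1
  have h := mul_thetaCoeff n k
  have h' := mul_thetaCoeff n (k + 1)
  have hc := choose_mul_add_choose_mul n k
  simp only [Nat.choose_one_right] at hn hk
  apply Nat.eq_of_mul_eq_mul_left (by omega : 0 < (2 * k + 1) * 2)
  zify at *
  linear_combination (2 * k + 1) * (2 * k + 2) * h' - (n * (n + 1) - k * (k + 1)) * h +
    (2 * n + 1) * hc + (2 * k + 1) * thetaCoeff n k * (hn - hk)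

section

variable {R : Type*} [CommRing R]

section CharThree

variable [CharP R 3]

lemma thetaCoeff_two (n : ℕ) :
    (thetaCoeff n 2 : R) = ((n + 1).choose 2 - 1) * thetaCoeff n 1 := by
  have h := congrArg (Nat.cast : ℕ → R) (thetaCoeff_succ n 1)
  have h3 : (3 : R) = 0 := CharP.ofNat_eq_zero R 3
  simp only [Nat.choose_self, Nat.reduceAdd] at h
  push_cast at h
  linear_combination h - 3 * thetaCoeff n 2 * h3

lemma choose_mul_thetaCoeff_two (n : ℕ) : ((n + 1).choose 2 * thetaCoeff n 2 : R) = 0 := by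
  have h := congrArg (Nat.cast : ℕ → R) (thetaCoeff_succ n 2)
  have h3 : (3 : R) = 0 := CharP.ofNat_eq_zero R 3
  simp only [show (2 + 1).choose 2 = 3 from rfl] at h
  push_cast at h
  linear_combination -h + (thetaCoeff n 2 + 7 * thetaCoeff n 3) * h3

lemma choose_mul_thetaCoeff_three (n : ℕ) : ((n + 1).choose 2 * thetaCoeff n 3 : R) = 0 := by
  have h := congrArg (Nat.cast : ℕ → R) (thetaCoeff_succ n 3)
  have h3 : (3 : R) = 0 := CharP.ofNat_eq_zero R 3
  simp only [show (3 + 1).choose 2 = 6 from rfl] at h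
  push_cast at h
  linear_combination -h + (2 * thetaCoeff n 3 + 12 * thetaCoeff n 4) * h3

end CharThree

/-- The polynomial `θ_n(u)`, as a power series. -/
noncomputable def theta (R : Type*) [CommRing R] (n : ℕ) : R⟦X⟧ := mk fun k => (thetaCoeff n k : R)

lemma theta_zero : theta R 0 = 1 := by
  ext k
  rw [theta, coeff_mk, thetaCoeff_zero_left, coeff_one]
  split_ifs <;> simp

lemma X_add_two_mul_theta_zero : (X + 2) * theta R 0 = theta R 1 - theta R 0 := by
  have h : theta R 1 = X + 3 := by
    ext k
    rw [theta, coeff_mk, thetaCoeff_one_left, map_add, coeff_X, ← map_ofNat C 3, coeff_C]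
    split_ifs <;> simp_all
  rw [h, theta_zero]
  ring

lemma X_add_two_mul_theta_succ (n : ℕ) :
    (X + 2) * theta R (n + 1) = theta R (n + 2) + theta R n := by
  ext k
  rw [show (2 : R⟦X⟧) = C 2 from (map_ofNat C 2).symm, add_mul, map_add, map_add, coeff_C_mul]
  simp only [theta]
  rcases k with - | k
  · rw [coeff_zero_X_mul, coeff_mk, coeff_mk, coeff_mk]
    rw [zero_add]
    exact_mod_cast congrArg (Nat.cast : ℕ → R) (thetaCoeff_add_two_zero n).symm
  · rw [coeff_succ_X_mul, coeff_mk, coeff_mk, coeff_mk, coeff_mk]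
    exact_mod_cast congrArg (Nat.cast : ℕ → R) (thetaCoeff_add_two_succ n k).symm

lemma X_add_two_mul_sum_theta (a : ℕ → R⟦X⟧) (K : ℕ) :
    (X + 2) * ∑ n ∈ range (K + 1), a n * theta R n =
      (a 1 - a 0) * theta R 0 + ∑ n ∈ range K, (a n + a (n + 2)) * theta R (n + 1) +
        a K * theta R (K + 1) - a (K + 1) * theta R K := by
  induction K with
  | zero =>
    simp only [zero_add, range_one, sum_singleton, range_zero, sum_empty]
    linear_combination a 0 * X_add_two_mul_theta_zero (R := R)
  | succ K ih =>
    rw [sum_range_succ, mul_add, ih, sum_range_succ _ K]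
    linear_combination a (K + 1) * X_add_two_mul_theta_succ (R := R) K

/-- The coefficient of `θ_n` in the finite form of Jacobi's triple product identity. -/
def tripleCoeff (q : R) (N n : ℕ) : R :=
  (-1) ^ n * q ^ (n + 1).choose 2 * qBinom q (2 * N + 1) (N + n + 1)

lemma tripleCoeff_eq_zero (q : R) {N n : ℕ} (h : N < n) : tripleCoeff q N n = 0 := by
  rw [tripleCoeff, qBinom_eq_zero_of_lt q (by omega), mul_zero]

lemma tripleCoeff_succ_zero (q : R) (N : ℕ) :
    tripleCoeff q (N + 1) 0 = (1 + q ^ (2 * (N + 1))) * tripleCoeff q N 0 -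
      q ^ (N + 1) * (tripleCoeff q N 1 - tripleCoeff q N 0) := by
  have h := qBinom_add_two q (m := 2 * N + 1) (k := N) (by omega)
  have hsymm : qBinom q (2 * N + 1) N = qBinom q (2 * N + 1) (N + 1) := by
    rw [show 2 * N + 1 = N + (N + 1) by ring, qBinom_symm]
  rw [hsymm, show 2 * N + 1 - N = N + 1 by omega] at h
  simp only [tripleCoeff, show 2 * (N + 1) + 1 = 2 * N + 1 + 2 by ring,
    show (0 + 1).choose 2 = 0 from rfl, show (1 + 1).choose 2 = 1 from rfl, add_zero, h]
  ring

lemma tripleCoeff_succ_succ (q : R) {N n : ℕ} (hn : n ≤ N) :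
    tripleCoeff q (N + 1) (n + 1) = (1 + q ^ (2 * (N + 1))) * tripleCoeff q N (n + 1) -
      q ^ (N + 1) * (tripleCoeff q N n + tripleCoeff q N (n + 2)) := by
  have h := qBinom_add_two q (m := 2 * N + 1) (k := N + n + 1) (by omega)
  obtain ⟨d, rfl⟩ := Nat.exists_eq_add_of_le hn
  rw [show 2 * (n + d) + 1 - (n + d + n + 1) = d by omega] at h
  have hT (i : ℕ) : (i + 1 + 1).choose 2 = (i + 1) + (i + 1).choose 2 := by
    rw [Nat.choose_succ_succ', Nat.choose_one_right]
  simp only [tripleCoeff, show 2 * (n + d + 1) + 1 = 2 * (n + d) + 1 + 2 by ring,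
    show n + d + 1 + (n + 1) + 1 = n + d + n + 1 + 2 by ring,
    show n + d + (n + 1) + 1 = n + d + n + 1 + 1 by ring,
    show n + d + (n + 2) + 1 = n + d + n + 1 + 2 by ring, hT (n + 1), hT n, h]
  ring

lemma prod_Icc_eq_sum_tripleCoeff (q : R) (N : ℕ) :
    ∏ m ∈ Icc 1 N, (C ((1 - q ^ m) ^ 2) - C (q ^ m) * X : R⟦X⟧) =
      ∑ n ∈ range (N + 1), C (tripleCoeff q N n) * theta R n := by
  induction N with
  | zero => simp [tripleCoeff, theta_zero, qBinom_self]
  | succ N ih =>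
    have hfactor : (C ((1 - q ^ (N + 1)) ^ 2) - C (q ^ (N + 1)) * X : R⟦X⟧) =
        C (1 + q ^ (2 * (N + 1))) - C (q ^ (N + 1)) * (X + 2) := by
      rw [show (1 - q ^ (N + 1)) ^ 2 = 1 + q ^ (2 * (N + 1)) - q ^ (N + 1) * 2 by ring, map_sub,
        map_mul, map_ofNat]
      ring
    have hX := X_add_two_mul_sum_theta (fun n => C (tripleCoeff q N n)) (N + 1)
    rw [sum_range_succ] at hX
    have hsucc : ∑ n ∈ range (N + 1), C (tripleCoeff q N n) * theta R n =
        ∑ n ∈ range (N + 1), C (tripleCoeff q N (n + 1)) * theta R (n + 1) +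
          C (tripleCoeff q N 0) * theta R 0 := by
      rw [← sum_range_succ' (fun n => C (tripleCoeff q N n) * theta R n), sum_range_succ _ (N + 1),
        tripleCoeff_eq_zero q (by omega), map_zero, zero_mul, add_zero]
    have hrec : ∑ n ∈ range (N + 1), C (tripleCoeff q (N + 1) (n + 1)) * theta R (n + 1) =
        ∑ n ∈ range (N + 1), C ((1 + q ^ (2 * (N + 1))) * tripleCoeff q N (n + 1) -
          q ^ (N + 1) * (tripleCoeff q N n + tripleCoeff q N (n + 2))) * theta R (n + 1) :=
      sum_congr rfl fun n hn => by rw [tripleCoeff_succ_succ q (by rw [mem_range] at hn; omega)]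
    simp only [tripleCoeff_eq_zero q (by omega : N < N + 1),
      tripleCoeff_eq_zero q (by omega : N < N + 1 + 1), map_zero, zero_mul, add_zero,
      sub_zero] at hX
    rw [prod_Icc_succ_top (by omega), ih, hfactor, mul_comm, sub_mul, mul_assoc, hX, hsucc,
      sum_range_succ' _ (N + 1), tripleCoeff_succ_zero, hrec]
    simp only [map_sub, map_mul, map_add, sub_mul, sum_sub_distrib, mul_assoc, ← mul_sum, add_mul,
      sum_add_distrib]
    ring

end

end Theta

section LambertNodes

variable {A : Type*} [CommRing A]

/-- The element `q` can serve as the base of `q`-series: all `1 - q ^ r` are invertible. This holds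
for the variable of a power series ring and for the elements of a field that are not roots of
unity. -/
def IsQBase (q : A) : Prop := ∀ r ≠ 0, IsUnit (1 - q ^ r)

/-- The geometric series `1 / (1 - q ^ r)`; it is `0` for `r = 0`. -/
noncomputable def invOneSub (q : A) (r : ℕ) : A := Ring.inverse (1 - q ^ r)

/-- The term `q ^ m / (1 - q ^ m) ^ 2` of the Lambert series of the divisor sums. -/
noncomputable def lambert (q : A) (m : ℕ) : A := q ^ m * invOneSub q m ^ 2

/-- The quotient `(1 - q ^ j) / (1 + q ^ j)`. -/
noncomputable def cayley (q : A) (j : ℕ) : A := (1 - q ^ j) * Ring.inverse (1 + q ^ j)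

/-- The element `1 / (1 - q ^ (m - j))`, where `m - j` may be negative. -/
noncomputable def invOneSubDiff (q : A) (j m : ℕ) : A :=
  if j < m then invOneSub q (m - j) else 1 - invOneSub q (j - m)

/-- The ratio `x m / (x j - x m)` of the Lambert nodes `x = lambert q`, in partial fractions. -/
noncomputable def lambertRatio (q : A) (j m : ℕ) : A :=
  cayley q j * (invOneSubDiff q j m - invOneSub q (m + j))

lemma derivation_pow_self {R : Type*} [CommSemiring R] [Algebra R A] (D : Derivation R A A)
    {q : A} (hD : D q = q) (r : ℕ) : D (q ^ r) = r * q ^ r := by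
  rcases r with - | r
  · simp
  · rw [Derivation.leibniz_pow, hD, Nat.add_sub_cancel, nsmul_eq_mul, smul_eq_mul, ← pow_succ]

namespace IsQBase

variable {q : A} {j m : ℕ}

lemma map {B : Type*} [CommRing B] (f : A →+* B) (hq : IsQBase q) : IsQBase (f q) := by
  intro r hr
  rw [← map_pow, ← map_one f, ← map_sub]
  exact (hq r hr).map f

lemma invOneSub_mul (hq : IsQBase q) (hj : j ≠ 0) : invOneSub q j * (1 - q ^ j) = 1 :=
  Ring.inverse_mul_cancel _ (hq j hj)

lemma map_invOneSub {B : Type*} [CommRing B] (f : A →+* B) (hq : IsQBase q) (r : ℕ) :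
    f (invOneSub q r) = invOneSub (f q) r := by
  rcases eq_or_ne r 0 with rfl | hr
  · simp [invOneSub]
  · have hinv := congrArg f (hq.invOneSub_mul hr)
    rw [map_mul, map_sub, map_one, map_pow] at hinv
    exact ((hq.map f) r hr).mul_right_cancel (hinv.trans ((hq.map f).invOneSub_mul hr).symm)

lemma map_lambert {B : Type*} [CommRing B] (f : A →+* B) (hq : IsQBase q) (m : ℕ) :
    f (lambert q m) = lambert (f q) m := by
  rw [lambert, map_mul, map_pow, map_pow, hq.map_invOneSub, ← lambert]

lemma isUnit_one_add_pow (hq : IsQBase q) (hj : j ≠ 0) : IsUnit (1 + q ^ j) := by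
  refine isUnit_of_mul_isUnit_right (x := 1 - q ^ j) ?_
  convert! hq (j + j) (by omega) using 1
  ring

lemma cayley_mul_one_add (hq : IsQBase q) (hj : j ≠ 0) : cayley q j * (1 + q ^ j) = 1 - q ^ j := by
  rw [cayley, mul_assoc, Ring.inverse_mul_cancel _ (hq.isUnit_one_add_pow hj), mul_one]

lemma cayley_mul (hq : IsQBase q) (hj : j ≠ 0) : cayley q j * (2 * invOneSub q j - 1) = 1 := by
  linear_combination (invOneSub q j) * hq.cayley_mul_one_add hj +
    (1 + cayley q j) * hq.invOneSub_mul hj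

lemma lambert_eq (hq : IsQBase q) (m : ℕ) : lambert q m = invOneSub q m ^ 2 - invOneSub q m := by
  rcases eq_or_ne m 0 with rfl | hm
  · simp [lambert, invOneSub]
  · rw [lambert]
    linear_combination -(invOneSub q m) * hq.invOneSub_mul hm

lemma invOneSub_mul_invOneSub (hq : IsQBase q) (hj : j ≠ 0) (hm : m ≠ 0) :
    invOneSub q j * invOneSub q m =
      invOneSub q (j + m) * (invOneSub q j + invOneSub q m - 1) := by
  have h : invOneSub q (j + m) * (1 - q ^ j * q ^ m) = 1 := by
    rw [← pow_add, hq.invOneSub_mul (by omega)]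
  linear_combination -invOneSub q j * invOneSub q m * h +
    invOneSub q (j + m) * (invOneSub q j - 1) * hq.invOneSub_mul hm +
    invOneSub q (j + m) * invOneSub q m * q ^ m * hq.invOneSub_mul hj

lemma sq_mul_invOneSub_two_mul (hq : IsQBase q) (hj : j ≠ 0) :
    (2 * invOneSub q j - 1) * invOneSub q (j + j) = invOneSub q j ^ 2 := by
  linear_combination -hq.invOneSub_mul_invOneSub hj hj

lemma invOneSubDiff_mul_invOneSub (hq : IsQBase q) (hj : j ≠ 0) (hm : m ≠ 0) (h : j ≠ m) :
    invOneSubDiff q j m * invOneSub q j =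
      invOneSub q m * (invOneSubDiff q j m + invOneSub q j - 1) := by
  rw [invOneSubDiff]
  split_ifs with hlt
  · have := hq.invOneSub_mul_invOneSub (j := m - j) (m := j) (by omega) hj
    rwa [Nat.sub_add_cancel hlt.le] at this
  · have := hq.invOneSub_mul_invOneSub (j := j - m) (m := m) (by omega) hm
    rw [Nat.sub_add_cancel (by omega)] at this
    linear_combination this

lemma invOneSubDiff_mul_invOneSub_add (hq : IsQBase q) (hj : j ≠ 0) (h : j ≠ m) :
    invOneSubDiff q j m * invOneSub q (m + j) = invOneSub q (m + j) +
      invOneSub q (j + j) * (invOneSubDiff q j m - invOneSub q (m + j)) := by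
  rw [invOneSubDiff]
  split_ifs with hlt
  · have := hq.invOneSub_mul_invOneSub (j := m - j) (m := j + j) (by omega) (by omega)
    rw [show m - j + (j + j) = m + j by omega] at this
    linear_combination -this
  · have := hq.invOneSub_mul_invOneSub (j := j - m) (m := m + j) (by omega) (by omega)
    rw [show j - m + (m + j) = j + j by omega] at this
    linear_combination -this

lemma lambertRatio_mul_sub (hq : IsQBase q) (hj : j ≠ 0) (hm : m ≠ 0) (h : j ≠ m) :
    lambertRatio q j m * (lambert q j - lambert q m) = lambert q m := by
  have hdiff := hq.invOneSubDiff_mul_invOneSub hj hm h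
  have hsum := hq.invOneSub_mul_invOneSub hm hj
  have hc := hq.cayley_mul hj
  rw [lambertRatio, hq.lambert_eq, hq.lambert_eq]
  linear_combination cayley q j * (invOneSub q j + invOneSub q m - 1) * hdiff +
    cayley q j * (invOneSub q j - invOneSub q m) * hsum +
    (invOneSub q m ^ 2 - invOneSub q m) * hc

lemma one_add_lambertRatio (hq : IsQBase q) (hj : j ≠ 0) (hm : m ≠ 0) (h : j ≠ m) :
    1 + lambertRatio q j m =
      (1 - q ^ m) ^ 2 * (invOneSubDiff q j m * invOneSub q (m + j)) := by
  have hdiff := hq.invOneSubDiff_mul_invOneSub hj hm h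
  have hsum := hq.invOneSub_mul_invOneSub hm hj
  have hprod := hq.invOneSubDiff_mul_invOneSub_add hj h
  have hc := hq.cayley_mul hj
  have hsq := hq.sq_mul_invOneSub_two_mul hj
  have hm' := hq.invOneSub_mul hm
  rw [lambertRatio]
  generalize invOneSub q m = g at *
  generalize invOneSub q (m + j) = s at *
  generalize invOneSubDiff q j m = d at *
  generalize invOneSub q j = u at *
  generalize invOneSub q (j + j) = G at *
  generalize 1 - q ^ m = p at *
  generalize cayley q j = c at *
  have key : (2 * u - 1 + (d - s)) * g ^ 2 = (2 * u - 1) * (d * s) := by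
    linear_combination -(u + g) * hdiff + (g - u + 1) * hsum - (2 * u - 1) * hprod - (d - s) * hsq
  linear_combination c * p ^ 2 * key - (1 - p ^ 2 * (d * s)) * hc -
    (g * p + 1) * (c * (2 * u - 1) + c * (d - s)) * hm'

lemma lambert_ne_zero [IsDomain A] (hq : IsQBase q) (hq0 : q ≠ 0) (hm : m ≠ 0) :
    lambert q m ≠ 0 :=
  mul_ne_zero (pow_ne_zero _ hq0) (pow_ne_zero _ (left_ne_zero_of_mul_eq_one (hq.invOneSub_mul hm)))

lemma nodeRatios [IsDomain A] (hq : IsQBase q) (hq0 : q ≠ 0) {s : Finset ℕ} (hs : 0 ∉ s) :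
    NodeRatios (lambert q) (lambertRatio q) s where
  ne_zero _ hm := hq.lambert_ne_zero hq0 (ne_of_mem_of_not_mem hm hs)
  ratio_mul_sub _ hj _ hm := hq.lambertRatio_mul_sub (ne_of_mem_of_not_mem hj hs)
    (ne_of_mem_of_not_mem (mem_of_mem_erase hm) hs) (ne_of_mem_erase hm).symm

lemma lambert_dist_eq (hq : IsQBase q) :
    (if j < m then lambert q (m - j) else lambert q (j - m)) =
      invOneSubDiff q j m ^ 2 - invOneSubDiff q j m := by
  rw [invOneSubDiff]
  split_ifs <;> rw [hq.lambert_eq]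
  ring

lemma invOneSubDiff_sub_sq (hq : IsQBase q) (hj : j ≠ 0) (h : j ≠ m) :
    (invOneSubDiff q j m - invOneSub q (m + j)) ^ 2 =
      (if j < m then lambert q (m - j) else lambert q (j - m)) + lambert q (m + j) +
        (invOneSubDiff q j m - invOneSub q (m + j)) * (1 - 2 * invOneSub q (j + j)) := by
  rw [hq.lambert_dist_eq, hq.lambert_eq]
  linear_combination -2 * hq.invOneSubDiff_mul_invOneSub_add hj h

section Derivation

variable {R : Type*} [CommSemiring R] [Algebra R A] (D : Derivation R A A)

lemma derivation_invOneSub (hq : IsQBase q) (hD : D q = q) (hj : j ≠ 0) :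
    D (invOneSub q j) = j * lambert q j := by
  have h := congrArg D (hq.invOneSub_mul hj)
  rw [Derivation.leibniz, map_sub, derivation_pow_self D hD, Derivation.map_one_eq_zero,
    smul_eq_mul, smul_eq_mul] at h
  rw [lambert]
  linear_combination invOneSub q j * h - D (invOneSub q j) * hq.invOneSub_mul hj

end Derivation

section CharThree

variable [CharP A 3]

lemma one_add_invOneSub_mul_cayley (hq : IsQBase q) (hj : j ≠ 0) :
    (1 + invOneSub q j) * cayley q j = -1 := by
  have h3 : (3 : A) = 0 := CharP.ofNat_eq_zero A 3
  linear_combination -hq.cayley_mul hj + invOneSub q j * cayley q j * h3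

lemma cayley_eq (hq : IsQBase q) (hj : j ≠ 0) :
    cayley q j = invOneSub q j + invOneSub q (j + j) - 1 := by
  have h3 : (3 : A) = 0 := CharP.ofNat_eq_zero A 3
  linear_combination cayley q j * (invOneSub q j - invOneSub q j ^ 2) * h3 +
    (invOneSub q j - 1 + invOneSub q (j + j)) * hq.cayley_mul hj -
    cayley q j * hq.sq_mul_invOneSub_two_mul hj

lemma one_add_lambert_mul_cayley_sq (hq : IsQBase q) (hj : j ≠ 0) :
    (1 + lambert q j) * cayley q j ^ 2 = 1 := by
  have h3 : (3 : A) = 0 := CharP.ofNat_eq_zero A 3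
  rw [hq.lambert_eq]
  linear_combination ((1 + invOneSub q j) * cayley q j - 1) *
    hq.one_add_invOneSub_mul_cayley hj - invOneSub q j * cayley q j ^ 2 * h3

lemma cayley_cube (hq : IsQBase q) (hj : j ≠ 0) :
    cayley q j ^ 3 = -cayley q j + cayley q j ^ 2 * (1 - 2 * invOneSub q (j + j)) := by
  have h3 : (3 : A) = 0 := CharP.ofNat_eq_zero A 3
  have hG : invOneSub q (j + j) = cayley q j - invOneSub q j + 1 := by
    linear_combination -hq.cayley_eq hj
  rw [hG]
  linear_combination (cayley q j ^ 3 + cayley q j ^ 2 + cayley q j) * h3 -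
    2 * cayley q j * hq.one_add_invOneSub_mul_cayley hj

lemma cayley_quartic (hq : IsQBase q) (hj : j ≠ 0) :
    1 + cayley q j ^ 2 + cayley q j ^ 2 * (lambert q j + lambert q (j + j)) =
      cayley q j ^ 3 * (1 - 2 * invOneSub q (j + j)) := by
  have h3 : (3 : A) = 0 := CharP.ofNat_eq_zero A 3
  have hw := hq.one_add_invOneSub_mul_cayley hj
  have hG : invOneSub q (j + j) = cayley q j - invOneSub q j + 1 := by
    linear_combination -hq.cayley_eq hj
  rw [hq.lambert_eq, hq.lambert_eq, hG]
  generalize cayley q j = c at *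
  generalize invOneSub q j = u at *
  linear_combination (2 * (u * c - 1 - c) - 2 * c - 4 * c ^ 2) * hw +
    (1 + 2 * c + 3 * c ^ 2 + 2 * c ^ 3 + c ^ 4) * h3

variable {R : Type*} [CommSemiring R] [Algebra R A] (D : Derivation R A A)

lemma derivation_cayley (hq : IsQBase q) (hD : D q = q) (hj : j ≠ 0) :
    D (cayley q j) = j * (lambert q j * cayley q j ^ 2) := by
  have h := congrArg D (hq.one_add_invOneSub_mul_cayley hj)
  rw [Derivation.leibniz, map_add, derivation_invOneSub D hq hD hj, map_neg,
    Derivation.map_one_eq_zero, smul_eq_mul, smul_eq_mul] at h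
  linear_combination -cayley q j * h + D (cayley q j) * hq.one_add_invOneSub_mul_cayley hj

lemma derivation_lambert_mul_cayley_sq (hq : IsQBase q) (hD : D q = q) (hj : j ≠ 0) :
    D (lambert q j * cayley q j ^ 2) = lambert q j * (j * cayley q j ^ 3) := by
  have h3 : (3 : A) = 0 := CharP.ofNat_eq_zero A 3
  have h : lambert q j * cayley q j ^ 2 = 1 - cayley q j ^ 2 := by
    linear_combination hq.one_add_lambert_mul_cayley_sq hj
  rw [h, map_sub, Derivation.map_one_eq_zero, Derivation.leibniz_pow,
    derivation_cayley D hq hD hj, nsmul_eq_mul, smul_eq_mul]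
  push_cast
  linear_combination -j * lambert q j * cayley q j ^ 3 * h3

lemma derivation_lambert_sq_mul_cayley_sq (hq : IsQBase q) (hD : D q = q) (hj : j ≠ 0) :
    D (lambert q j ^ 2 * cayley q j ^ 2) =
      lambert q j ^ 2 * (j * (cayley q j + cayley q j ^ 3)) := by
  have h3 : (3 : A) = 0 := CharP.ofNat_eq_zero A 3
  have hxc := hq.one_add_lambert_mul_cayley_sq hj
  have h : lambert q j ^ 2 * cayley q j ^ 2 = lambert q j - lambert q j * cayley q j ^ 2 := by
    linear_combination lambert q j * hxc
  have hx : D (lambert q j) = j * lambert q j * (2 * invOneSub q j - 1) := by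
    rw [hq.lambert_eq, map_sub, Derivation.leibniz_pow, derivation_invOneSub D hq hD hj,
      ← hq.lambert_eq, nsmul_eq_mul, smul_eq_mul]
    push_cast
    ring
  rw [h, map_sub, derivation_lambert_mul_cayley_sq D hq hD hj, hx]
  linear_combination j * lambert q j * ((invOneSub q j - 1 - cayley q j) * h3 -
    (invOneSub q j - 2) * hq.one_add_invOneSub_mul_cayley hj - cayley q j * hxc -
    cayley q j * hq.lambert_eq j)

end CharThree

end IsQBase

end LambertNodes

section LambertResidues

@[to_additive]
lemma prod_Icc_erase_add {M : Type*} [CommMonoid M] (f : ℕ → M) {j : ℕ} (hj : j ≠ 0) (t : ℕ) :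
    (∏ m ∈ (Icc 1 (j + t)).erase j, f (m + j)) * f (j + j) * ∏ r ∈ Icc 1 j, f r =
      ∏ r ∈ Icc 1 (t + (j + j)), f r := by
  rw [prod_erase_mul (Icc 1 (j + t)) (fun m => f (m + j)) (mem_Icc.2 (by omega)), mul_comm]
  simp only [← Ico_add_one_right_eq_Icc]
  rw [prod_Ico_add', show 1 + j = j + 1 from add_comm _ _,
    prod_Ico_consecutive f (by omega) (by omega), show j + t + 1 + j = t + (j + j) + 1 by ring]

@[to_additive]
lemma prod_Icc_erase_ite_sub {M : Type*} [CommMonoid M] (f g : ℕ → M) (j t : ℕ) :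
    ∏ m ∈ (Icc 1 (j + t)).erase j, (if j < m then f (m - j) else g (j - m)) =
      (∏ r ∈ Icc 1 t, f r) * ∏ r ∈ Ico 1 j, g r := by
  rw [prod_ite]
  congr 1
  · refine prod_nbij' (· - j) (· + j) ?_ ?_ ?_ ?_ ?_ <;>
      simp only [mem_filter, mem_erase, mem_Icc, implies_true] <;> omega
  · refine prod_nbij' (j - ·) (j - ·) ?_ ?_ ?_ ?_ ?_ <;>
      simp only [mem_filter, mem_erase, mem_Icc, mem_Ico, implies_true] <;> omega

variable {A : Type*} [CommRing A] {q : A}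

lemma prod_Ico_pow_sq (q : A) (j : ℕ) : ∏ r ∈ Ico 1 j, (q ^ r) ^ 2 = q ^ (j * (j - 1)) := by
  simp only [← pow_mul, prod_pow_eq_pow_sum]
  rw [← sum_mul, ← sum_range_id_mul_two, range_eq_Ico]
  rcases j with - | j
  · simp
  · rw [sum_eq_sum_Ico_succ_bot (Nat.succ_pos j), zero_add]

namespace IsQBase

lemma prod_invOneSubDiff_sq (hq : IsQBase q) (j t : ℕ) :
    (∏ m ∈ (Icc 1 (j + t)).erase j, invOneSubDiff q j m) ^ 2 *
      ((∏ r ∈ Icc 1 t, (1 - q ^ r)) * ∏ r ∈ Ico 1 j, (1 - q ^ r)) ^ 2 = q ^ (j * (j - 1)) := by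
  have hpow : q ^ (j * (j - 1)) =
      ∏ m ∈ (Icc 1 (j + t)).erase j, if j < m then 1 else (q ^ (j - m)) ^ 2 := by
    rw [prod_Icc_erase_ite_sub (fun _ => 1) (fun r => (q ^ r) ^ 2), prod_const_one, one_mul,
      prod_Ico_pow_sq]
  rw [hpow, ← prod_Icc_erase_ite_sub (fun r => 1 - q ^ r) (fun r => 1 - q ^ r), ← mul_pow,
    ← prod_mul_distrib, ← prod_pow]
  refine prod_congr rfl fun m hm => ?_
  have hmj := ne_of_mem_erase hm
  rw [invOneSubDiff]
  split_ifs with h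
  · rw [hq.invOneSub_mul (by omega), one_pow]
  · have hg := hq.invOneSub_mul (j := j - m) (by omega)
    linear_combination (invOneSub q (j - m) * (1 - q ^ (j - m)) + 1 - 2 * (1 - q ^ (j - m))) * hg

lemma ratioResidue_sq_mul (hq : IsQBase q) {j : ℕ} (hj : j ≠ 0) (t : ℕ) :
    ratioResidue (lambertRatio q) (Icc 1 (j + t)) j ^ 2 *
      (qPoch q q t * qPoch q q (t + (j + j))) ^ 2 =
        q ^ (j * (j - 1)) * (1 + q ^ j) ^ 2 * qPoch q q (j + t) ^ 4 := by
  have hfactor : ratioResidue (lambertRatio q) (Icc 1 (j + t)) j =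
      (∏ m ∈ (Icc 1 (j + t)).erase j, (1 - q ^ m)) ^ 2 *
        ((∏ m ∈ (Icc 1 (j + t)).erase j, invOneSubDiff q j m) *
          ∏ m ∈ (Icc 1 (j + t)).erase j, invOneSub q (m + j)) := by
    rw [ratioResidue, ← prod_pow, ← prod_mul_distrib, ← prod_mul_distrib]
    refine prod_congr rfl fun m hm => hq.one_add_lambertRatio hj ?_ (ne_of_mem_erase hm).symm
    have := mem_Icc.1 (mem_of_mem_erase hm)
    omega
  have hinv : (∏ m ∈ (Icc 1 (j + t)).erase j, invOneSub q (m + j)) *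
      ∏ m ∈ (Icc 1 (j + t)).erase j, (1 - q ^ (m + j)) = 1 := by
    rw [← prod_mul_distrib]
    exact prod_eq_one fun m _ => hq.invOneSub_mul (by omega)
  have hdiff := hq.prod_invOneSubDiff_sq j t
  have hN : (∏ m ∈ (Icc 1 (j + t)).erase j, (1 - q ^ m)) * (1 - q ^ j) = qPoch q q (j + t) := by
    rw [qPoch_self_eq_prod_Icc, prod_erase_mul _ _ (mem_Icc.2 (by omega))]
  have hj' : (∏ r ∈ Ico 1 j, (1 - q ^ r)) * (1 - q ^ j) = ∏ r ∈ Icc 1 j, (1 - q ^ r) :=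
    prod_Ico_mul_eq_prod_Icc (Nat.one_le_iff_ne_zero.2 hj)
  rw [hfactor, qPoch_self_eq_prod_Icc q (t + _), ← prod_Icc_erase_add _ hj, ← hN, ← hj', ← hdiff,
    qPoch_self_eq_prod_Icc q t]
  generalize ∏ m ∈ (Icc 1 (j + t)).erase j, invOneSub q (m + j) = S at *
  generalize ∏ m ∈ (Icc 1 (j + t)).erase j, (1 - q ^ (m + j)) = V at *
  generalize ∏ m ∈ (Icc 1 (j + t)).erase j, (1 - q ^ m) = U at *
  generalize ∏ m ∈ (Icc 1 (j + t)).erase j, invOneSubDiff q j m = E at *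
  generalize ∏ r ∈ Ico 1 j, (1 - q ^ r) = Q at *
  generalize ∏ r ∈ Icc 1 t, (1 - q ^ r) = P at *
  linear_combination (U ^ 4 * E ^ 2 * P ^ 2 * Q ^ 2 * (1 - q ^ j) ^ 4 * (1 + q ^ j) ^ 2) *
    (S * V + 1) * hinv

end IsQBase

end LambertResidues

section Nodes

variable {L : Type*} [Field L]

lemma residue_eq_residue_union_mul {ι : Type*} [DecidableEq ι] {x : ι → L} {s t : Finset ι}
    (hst : Disjoint s t) (hx : Set.InjOn x (s ∪ t : Finset ι)) {j : ι} (hj : j ∈ t)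
    (hxj : x j ≠ 0) :
    residue x t j = residue x (s ∪ t) j * ∏ m ∈ s, (1 - x m / x j) := by
  have hjs : j ∉ s := fun h => disjoint_left.1 hst h hj
  have hcancel : (∏ m ∈ s, x j / (x j - x m)) * ∏ m ∈ s, (1 - x m / x j) = 1 := by
    rw [← prod_mul_distrib]
    refine prod_eq_one fun m hm => ?_
    have hsub : x j - x m ≠ 0 := sub_ne_zero_of_mem_erase hx (mem_union_right s hj)
      (mem_erase.2 ⟨fun h => hjs (h ▸ hm), mem_union_left t hm⟩)
    field_simp
  rw [residue, residue, erase_union_distrib, erase_eq_of_notMem hjs,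
    prod_union (hst.mono_right (erase_subset j t)), mul_right_comm, hcancel, one_mul]

lemma sum_mul_hsymm_Icc {x : ℕ → L} {N : ℕ} (hx : Set.InjOn x (Icc 1 N))
    (hx0 : ∀ m ∈ Icc 1 N, x m ≠ 0) (w : ℕ → L) (k : ℕ) :
    ∑ n ∈ Icc 1 N, w n * hsymm x (Icc n N) k =
      ∑ j ∈ Icc 1 N, residue x (Icc 1 N) j * x j ^ k *
        ∑ n ∈ Icc 1 j, w n * ∏ m ∈ Ico 1 n, (1 - x m / x j) := by
  have hterm : ∀ n ∈ Icc 1 N, w n * hsymm x (Icc n N) k = ∑ j ∈ Icc n N,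
      residue x (Icc 1 N) j * x j ^ k * (w n * ∏ m ∈ Ico 1 n, (1 - x m / x j)) := by
    intro n hn
    rw [mem_Icc] at hn
    have hsub : Icc n N ⊆ Icc 1 N := Icc_subset_Icc_left hn.1
    have hunion : Ico 1 n ∪ Icc n N = Icc 1 N := by
      rw [← Ico_add_one_right_eq_Icc, Ico_union_Ico_eq_Ico hn.1 (by omega),
        Ico_add_one_right_eq_Icc]
    rw [hsymm_eq_sum_residue (nonempty_Icc.2 hn.2) (hx.mono (coe_subset.2 hsub))
      fun m hm => hx0 m (hsub hm), mul_sum]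
    refine sum_congr rfl fun j hj => ?_
    have hdisj : Disjoint (Ico 1 n) (Icc n N) :=
      disjoint_left.2 fun a ha hb => by rw [mem_Ico] at ha; rw [mem_Icc] at hb; omega
    rw [residue_eq_residue_union_mul hdisj (hunion ▸ hx) hj (hx0 j (hsub hj)), hunion]
    ring
  rw [sum_congr rfl hterm, sum_comm' (t' := Icc 1 N) (s' := fun j => Icc 1 j)]
  · simp only [mul_sum]
  · intro a b
    simp only [mem_Icc]
    omega

end Nodes

section Vandermonde

namespace IsQBase

variable {L : Type*} [Field L] {q : L}

lemma one_sub_pow_ne_zero (hq : IsQBase q) {r : ℕ} (hr : r ≠ 0) : 1 - q ^ r ≠ 0 := (hq r hr).ne_zero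

lemma one_sub_mul_pow_ne_zero (hq : IsQBase q) (n : ℕ) : 1 - q * q ^ n ≠ 0 := by
  rw [← pow_succ']
  exact hq.one_sub_pow_ne_zero n.succ_ne_zero

lemma qPoch_self_ne_zero (hq : IsQBase q) (n : ℕ) : qPoch q q n ≠ 0 :=
  prod_ne_zero_iff.2 fun _ _ => hq.one_sub_mul_pow_ne_zero _

lemma qPoch_inv_pow_recurrence (hq : IsQBase q) (hq0 : q ≠ 0) (b : L) (j n : ℕ) :
    qPoch q (q ^ (j + 1))⁻¹ (n + 1) * qPoch q b (n + 1) * q ^ (n + 1) / qPoch q q (n + 1) =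
      qPoch q (q ^ j)⁻¹ (n + 1) * qPoch q b (n + 1) * q ^ (n + 1) / qPoch q q (n + 1) -
        (q ^ j)⁻¹ * (1 - b) *
          (qPoch q (q ^ j)⁻¹ n * qPoch q (b * q) n * q ^ n / qPoch q q n) := by
  have hfirst : qPoch q (q ^ (j + 1))⁻¹ (n + 1) =
      (1 - (q ^ (j + 1))⁻¹) * qPoch q (q ^ j)⁻¹ n := by
    rw [qPoch_succ', pow_succ, mul_inv, inv_mul_cancel_right₀ hq0]
  have hlast := hq.one_sub_mul_pow_ne_zero n
  have hqq := hq.qPoch_self_ne_zero n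
  rw [hfirst, qPoch_succ q (q ^ j)⁻¹ n, qPoch_succ q q n, qPoch_succ' q b n]
  field_simp
  ring

-- The terminating `q`-Chu-Vandermonde sum, with lower parameter `0`.
lemma sum_qPoch_inv_pow_mul (hq : IsQBase q) (hq0 : q ≠ 0) (j : ℕ) (b : L) {M : ℕ} (hM : j < M) :
    ∑ n ∈ range M, qPoch q (q ^ j)⁻¹ n * qPoch q b n * q ^ n / qPoch q q n = b ^ j := by
  induction j generalizing b M with
  | zero =>
    obtain ⟨M, rfl⟩ := Nat.exists_eq_add_of_lt hM
    rw [zero_add, sum_range_succ', sum_eq_zero fun n _ => by simp [qPoch_succ']]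
    simp [qPoch_zero]
  | succ j ih =>
    obtain ⟨M, rfl⟩ : ∃ K, M = K + 1 := ⟨M - 1, by omega⟩
    have hb := ih b (M := M + 1) (by omega)
    rw [sum_range_succ'] at hb
    rw [sum_range_succ', sum_congr rfl fun n _ => hq.qPoch_inv_pow_recurrence hq0 b j n,
      sum_sub_distrib, ← mul_sum, ih (b * q) (by omega)]
    have hcancel : (q ^ j)⁻¹ * (1 - b) * (b * q) ^ j = (1 - b) * b ^ j := by
      rw [mul_pow]
      field_simp
    simp only [qPoch_zero] at hb ⊢
    linear_combination hb - hcancel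

lemma lambert_eq_div (q : L) (m : ℕ) : lambert q m = q ^ m / (1 - q ^ m) ^ 2 := by
  rw [lambert, invOneSub, Ring.inverse_eq_inv', inv_pow, div_eq_mul_inv]

lemma one_sub_lambert_div (hq : IsQBase q) (hq0 : q ≠ 0) {j m : ℕ} (hm : m ≠ 0) :
    1 - lambert q m / lambert q j =
      (1 - (q ^ j)⁻¹ * q ^ m) * (1 - q ^ j * q ^ m) / (1 - q ^ m) ^ 2 := by
  have hqm := hq.one_sub_pow_ne_zero hm
  rw [lambert_eq_div, lambert_eq_div]
  field_simp
  ring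

lemma prod_one_sub_lambert_div (hq : IsQBase q) (hq0 : q ≠ 0) (j n : ℕ) :
    ∏ m ∈ Ico 1 (n + 1), (1 - lambert q m / lambert q j) =
      qPoch q ((q ^ j)⁻¹ * q) n * qPoch q (q ^ j * q) n / qPoch q q n ^ 2 := by
  rw [prod_Ico_eq_prod_range, Nat.add_sub_cancel]
  simp only [qPoch, ← prod_mul_distrib, ← prod_pow, ← prod_div_distrib]
  refine prod_congr rfl fun i _ => ?_
  rw [hq.one_sub_lambert_div hq0 (by omega)]
  ring_nf

lemma sum_qPoch_mul_lambert (hq : IsQBase q) (hq0 : q ≠ 0) {j : ℕ} (hj : j ≠ 0) :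
    ∑ n ∈ Icc 1 j, qPoch q q n * lambert q n * ∏ m ∈ Ico 1 n, (1 - lambert q m / lambert q j) =
      lambert q j * (1 - q ^ j ^ 2) := by
  have hterm : ∀ n, qPoch q q (n + 1) * lambert q (n + 1) *
      ∏ m ∈ Ico 1 (n + 1), (1 - lambert q m / lambert q j) = -(lambert q j *
        (qPoch q (q ^ j)⁻¹ (n + 1) * qPoch q (q ^ j) (n + 1) * q ^ (n + 1) /
          qPoch q q (n + 1))) := by
    intro n
    have hqq := hq.qPoch_self_ne_zero n
    have hlast := hq.one_sub_mul_pow_ne_zero n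
    have hqj := hq.one_sub_pow_ne_zero hj
    rw [hq.prod_one_sub_lambert_div hq0, qPoch_succ' q (q ^ j)⁻¹, qPoch_succ' q (q ^ j),
      qPoch_succ q q n, lambert_eq_div, lambert_eq_div, pow_succ']
    field_simp
    ring
  have hvan := hq.sum_qPoch_inv_pow_mul hq0 j (q ^ j) (Nat.lt_succ_self j)
  rw [Nat.succ_eq_add_one, sum_range_succ', ← pow_mul, ← sq] at hvan
  rw [← Ico_add_one_right_eq_Icc, sum_Ico_eq_sum_range, Nat.add_sub_cancel]
  simp only [add_comm 1]
  rw [sum_congr rfl fun n _ => hterm n, sum_neg_distrib, ← mul_sum, ← hvan]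
  simp [qPoch_zero]

end IsQBase

end Vandermonde

section Transport

variable {A : Type*} [CommRing A] [IsDomain A] {q : A}

lemma IsQBase.sum_qPoch_mul_lambert_mul_hsymm (hq : IsQBase q) (hq0 : q ≠ 0) (k N : ℕ) :
    ∑ n ∈ Icc 1 N, qPoch q q n * lambert q n * hsymm (lambert q) (Icc n N) k =
      ∑ j ∈ Icc 1 N, ratioResidue (lambertRatio q) (Icc 1 N) j * lambert q j ^ (k + 1) *
        (1 - q ^ j ^ 2) := by
  have hinj := IsFractionRing.injective A (FractionRing A)
  set f := algebraMap A (FractionRing A)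
  have hfq := hq.map f
  have hfq0 : f q ≠ 0 := (map_ne_zero_iff f hinj).2 hq0
  have hnodes := hfq.nodeRatios hfq0 (s := Icc 1 N) (by simp)
  apply hinj
  simp only [map_sum, map_mul, map_qPoch, map_hsymm, map_pow, map_sub, map_one, hq.map_lambert]
  rw [sum_mul_hsymm_Icc hnodes.injOn hnodes.ne_zero]
  refine sum_congr rfl fun j hj => ?_
  rw [hfq.sum_qPoch_mul_lambert hfq0 (by rw [mem_Icc] at hj; omega),
    (hq.nodeRatios hq0 (by simp)).algebraMap_ratioResidue hj]
  simp only [hq.map_lambert]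
  ring

end Transport

section EulerOperator

variable {R : Type*} [CommRing R]

/-- The derivation `X d/dX` of power series, which multiplies the `n`-th coefficient by `n`. -/
noncomputable def eulerD (R : Type*) [CommRing R] : Derivation R R⟦X⟧ R⟦X⟧ :=
  (X : R⟦X⟧) • derivative R

lemma eulerD_X : eulerD R X = X := by
  simp [eulerD]

lemma coeff_eulerD (f : R⟦X⟧) (n : ℕ) : coeff n (eulerD R f) = n * coeff n f := by
  rw [eulerD, Derivation.smul_apply, smul_eq_mul]
  rcases n with - | n
  · simp
  · rw [coeff_succ_X_mul, coeff_derivative]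
    push_cast
    ring

lemma eulerD_mul (f g : R⟦X⟧) : eulerD R (f * g) = f * eulerD R g + g * eulerD R f :=
  (eulerD R).leibniz f g

instance powerSeries_charP (p : ℕ) [CharP R p] : CharP R⟦X⟧ p :=
  charP_of_injective_ringHom (C_injective (R := R)) p

lemma eulerD_cube [CharP R 3] (f : R⟦X⟧) : eulerD R (f ^ 3) = 0 := by
  have h3 : (3 : R⟦X⟧) = 0 := CharP.ofNat_eq_zero R⟦X⟧ 3
  rw [Derivation.leibniz_pow, nsmul_eq_mul, Nat.cast_ofNat, h3, zero_mul]

lemma eulerD_cube_mul [CharP R 3] (f g : R⟦X⟧) :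
    eulerD R (f ^ 3 * g) = f ^ 3 * eulerD R g := by
  rw [eulerD_mul, eulerD_cube, mul_zero, add_zero]

end EulerOperator

section Truncation

variable {R : Type*} [CommRing R] {M : ℕ} {a b c : R⟦X⟧}

/-- Reduction of power series modulo `X ^ M`. -/
noncomputable abbrev modX (R : Type*) [CommRing R] (M : ℕ) :
    R⟦X⟧ →+* R⟦X⟧ ⧸ Ideal.span {(X : R⟦X⟧) ^ M} :=
  Ideal.Quotient.mk _

lemma modX_eq_iff : modX R M a = modX R M b ↔ X ^ M ∣ a - b := by
  rw [Ideal.Quotient.eq, Ideal.mem_span_singleton]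

lemma coeff_eq_of_modX_eq {n : ℕ} (h : modX R M a = modX R M b) (hn : n < M) :
    coeff n a = coeff n b := by
  rw [modX_eq_iff, X_pow_dvd_iff] at h
  simpa only [map_sub, sub_eq_zero] using h n hn

lemma modX_eulerD (h : modX R M a = modX R M b) :
    modX R M (eulerD R a) = modX R M (eulerD R b) := by
  rw [modX_eq_iff, X_pow_dvd_iff] at h ⊢
  intro n hn
  rw [← map_sub, coeff_eulerD, h n hn, mul_zero]

lemma modX_mul_left {M' i : ℕ} (hc : X ^ i ∣ c) (h : modX R M a = modX R M b) (hM : M' ≤ i + M) :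
    modX R M' (c * a) = modX R M' (c * b) := by
  rw [modX_eq_iff] at h ⊢
  rw [← mul_sub]
  exact (pow_dvd_pow X hM).trans (by rw [pow_add]; exact mul_dvd_mul hc h)

lemma modX_sum_Icc_add (f : ℕ → R⟦X⟧) (c : R⟦X⟧) {t : ℕ}
    (h : ∀ r, t < r → modX R M (f r) = modX R M c) (d : ℕ) :
    modX R M (∑ r ∈ Icc 1 (t + d), f r) = modX R M (∑ r ∈ Icc 1 t, f r + d * c) := by
  induction d with
  | zero => simp
  | succ d ih =>
    rw [← add_assoc, sum_Icc_succ_top (by omega), map_add, ih, h _ (by omega), ← map_add]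
    push_cast
    ring_nf

lemma isQBase_X (R : Type*) [CommRing R] : IsQBase (X : R⟦X⟧) := fun r hr => by
  rw [PowerSeries.isUnit_iff_constantCoeff]
  simp [hr]

lemma modX_invOneSub {r : ℕ} (hr : M ≤ r) (h0 : r ≠ 0) :
    modX R M (invOneSub (X : R⟦X⟧) r) = modX R M 1 := by
  rw [modX_eq_iff]
  have h : invOneSub (X : R⟦X⟧) r - 1 = X ^ r * invOneSub X r := by
    linear_combination (isQBase_X R).invOneSub_mul h0
  rw [h]
  exact (pow_dvd_pow X hr).mul_right _

lemma X_pow_dvd_lambert_pow (j k : ℕ) : (X : R⟦X⟧) ^ (j * k) ∣ lambert X j ^ k := by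
  rw [lambert, mul_pow, ← pow_mul]
  exact dvd_mul_right _ _

lemma modX_lambert {r : ℕ} (hr : M ≤ r) : modX R M (lambert (X : R⟦X⟧) r) = modX R M 0 := by
  rw [modX_eq_iff, sub_zero, lambert]
  exact (pow_dvd_pow X hr).mul_right _

lemma modX_sum_lambert_add (t d : ℕ) :
    modX R (t + 1) (∑ r ∈ Icc 1 (t + d), lambert (X : R⟦X⟧) r) =
      modX R (t + 1) (∑ r ∈ Icc 1 t, lambert (X : R⟦X⟧) r) := by
  simpa only [mul_zero, add_zero] using
    modX_sum_Icc_add (lambert (X : R⟦X⟧)) 0 (fun _ => modX_lambert) d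

lemma isUnit_qPoch (n : ℕ) : IsUnit (qPoch (X : R⟦X⟧) X n) := by
  rw [PowerSeries.isUnit_iff_constantCoeff]
  simp [qPoch, map_prod]

lemma modX_qPoch_add (t d : ℕ) :
    modX R (t + 1) (qPoch (X : R⟦X⟧) X (t + d)) = modX R (t + 1) (qPoch X X t) := by
  induction d with
  | zero => rfl
  | succ d ih =>
    have h : modX R (t + 1) ((X : R⟦X⟧) * X ^ (t + d)) = 0 := by
      rw [← map_zero (modX R (t + 1)), modX_eq_iff, sub_zero, ← pow_succ']
      exact pow_dvd_pow X (by omega)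
    rw [← add_assoc, qPoch_succ, map_mul, map_sub, h, ih, map_one, sub_zero, mul_one]

end Truncation

section RatioSums

variable {R : Type*} [CommRing R] {j : ℕ}

-- The terms with index `m + j` cancel those with index `m - j`, apart from boundary terms.
lemma sum_invOneSubDiff_sub (hj : j ≠ 0) (t : ℕ) (q : R) :
    ∑ m ∈ (Icc 1 (j + t)).erase j, (invOneSubDiff q j m - invOneSub q (m + j)) =
      ∑ r ∈ Icc 1 t, invOneSub q r - ∑ r ∈ Icc 1 (t + (j + j)), invOneSub q r +
        (j - 1 + invOneSub q j + invOneSub q (j + j)) := by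
  have hadd := sum_Icc_erase_add (invOneSub q) hj t
  have hsub := sum_Icc_erase_ite_sub (invOneSub q) (fun r => 1 - invOneSub q r) j t
  have hIco : ∑ r ∈ Ico 1 j, invOneSub q r + invOneSub q j = ∑ r ∈ Icc 1 j, invOneSub q r :=
    sum_Ico_add_eq_sum_Icc (Nat.one_le_iff_ne_zero.2 hj)
  rw [sum_sub_distrib (s := Ico 1 j), sum_const, Nat.card_Ico, nsmul_one,
    Nat.cast_pred (Nat.pos_of_ne_zero hj)] at hsub
  rw [sum_sub_distrib]
  simp only [invOneSubDiff]
  linear_combination hsub - hadd - hIco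

variable [CharP R 3]

lemma modX_sum_invOneSubDiff_sub (hj : j ≠ 0) (t : ℕ) :
    modX R (t + 1) (∑ m ∈ (Icc 1 (j + t)).erase j,
      (invOneSubDiff (X : R⟦X⟧) j m - invOneSub X (m + j))) =
      modX R (t + 1) (cayley (X : R⟦X⟧) j - (j : R⟦X⟧)) := by
  have htail := modX_sum_Icc_add (invOneSub (X : R⟦X⟧)) 1 (t := t)
    (fun r hr => modX_invOneSub hr (Nat.ne_zero_of_lt hr)) (j + j)
  rw [sum_invOneSubDiff_sub hj, (isQBase_X R).cayley_eq hj, map_add, map_sub, htail, ← map_sub,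
    ← map_add]
  congr 1
  push_cast
  ring

lemma modX_sum_lambertRatio_sq (hj : j ≠ 0) (t : ℕ) :
    modX R (t + 1) (∑ m ∈ (Icc 1 (j + t)).erase j, lambertRatio (X : R⟦X⟧) j m ^ 2) =
      modX R (t + 1) (cayley (X : R⟦X⟧) j ^ 2 * (2 * psum (lambert X) (Icc 1 (j + t)) 1 -
        lambert X j - lambert X (j + j) +
          (cayley X j - (j : R⟦X⟧)) * (1 - 2 * invOneSub X (j + j)))) := by
  have hadd := sum_Icc_erase_add (lambert (X : R⟦X⟧)) hj t
  have hsub := sum_Icc_erase_ite_sub (lambert (X : R⟦X⟧)) (lambert X) j t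
  have hIco : ∑ r ∈ Ico 1 j, lambert (X : R⟦X⟧) r + lambert X j =
      ∑ r ∈ Icc 1 j, lambert X r :=
    sum_Ico_add_eq_sum_Icc (Nat.one_le_iff_ne_zero.2 hj)
  have hsum : ∑ m ∈ (Icc 1 (j + t)).erase j, lambertRatio (X : R⟦X⟧) j m ^ 2 =
      cayley X j ^ 2 * (∑ r ∈ Icc 1 t, lambert X r + ∑ r ∈ Icc 1 (t + (j + j)), lambert X r -
        lambert X j - lambert X (j + j) +
        (∑ m ∈ (Icc 1 (j + t)).erase j, (invOneSubDiff X j m - invOneSub X (m + j))) *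
          (1 - 2 * invOneSub X (j + j))) := by
    simp only [lambertRatio, mul_pow, ← mul_sum]
    rw [sum_congr rfl fun m hm => (isQBase_X R).invOneSubDiff_sub_sq hj (ne_of_mem_erase hm).symm,
      sum_add_distrib, sum_add_distrib, ← sum_mul]
    linear_combination cayley (X : R⟦X⟧) j ^ 2 * (hsub + hadd + hIco)
  have hlong := modX_sum_lambert_add (R := R) t (j + j)
  have hmid := modX_sum_lambert_add (R := R) t j
  have hdiff := modX_sum_invOneSubDiff_sub (R := R) hj t
  rw [add_comm t j] at hmid
  rw [hsum]
  simp only [psum, pow_one, map_mul, map_add, map_sub, map_pow, map_one, map_ofNat]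
    at hlong hmid hdiff ⊢
  rw [hlong, hmid, hdiff]
  ring

lemma modX_one_add_sum_lambertRatio_sub_sq (hj : j ≠ 0) (t : ℕ) :
    modX R (t + 1) (1 + ∑ m ∈ (Icc 1 (j + t)).erase j,
      (lambertRatio (X : R⟦X⟧) j m - lambertRatio X j m ^ 2)) =
      modX R (t + 1)
        ((j : R⟦X⟧) * cayley X j ^ 3 + psum (lambert X) (Icc 1 (j + t)) 1 * cayley X j ^ 2) := by
  have h3 : (3 : R⟦X⟧) = 0 := CharP.ofNat_eq_zero R⟦X⟧ 3
  rw [sum_sub_distrib, map_add, map_sub, modX_sum_lambertRatio_sq hj]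
  simp only [lambertRatio, ← mul_sum]
  rw [map_mul, modX_sum_invOneSubDiff_sub hj, ← map_mul, ← map_sub, ← map_add]
  congr 1
  linear_combination (isQBase_X R).cayley_quartic hj - j * (isQBase_X R).cayley_cube hj -
    psum (lambert X) (Icc 1 (j + t)) 1 * cayley X j ^ 2 * h3

lemma modX_two_sub_sum_lambertRatio_sq (hj : j ≠ 0) (t : ℕ) :
    modX R (t + 1) (2 - ∑ m ∈ (Icc 1 (j + t)).erase j, lambertRatio (X : R⟦X⟧) j m ^ 2) =
      modX R (t + 1)
        (lambert (X : R⟦X⟧) j * cayley X j ^ 2 + (j : R⟦X⟧) * (cayley X j + cayley X j ^ 3) +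
          psum (lambert X) (Icc 1 (j + t)) 1 * cayley X j ^ 2) := by
  have h3 : (3 : R⟦X⟧) = 0 := CharP.ofNat_eq_zero R⟦X⟧ 3
  rw [map_sub, modX_sum_lambertRatio_sq hj, ← map_sub]
  congr 1
  linear_combination (isQBase_X R).cayley_quartic hj - j * (isQBase_X R).cayley_cube hj -
    psum (lambert X) (Icc 1 (j + t)) 1 * cayley X j ^ 2 * h3 -
    (isQBase_X R).one_add_lambert_mul_cayley_sq hj

end RatioSums

section CubicSums

variable {R : Type*} [CommRing R]

/-- The sum `∑ j, r j ^ 3 * x j ^ (k + 1) / (1 + x j)` over `1 ≤ j ≤ N`, where `x j` are the Lambert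
nodes and `r j` their residues; in characteristic three `1 / (1 + x j)` is `cayley X j ^ 2`. -/
noncomputable def cubicSum (R : Type*) [CommRing R] (N k : ℕ) : R⟦X⟧ :=
  ∑ j ∈ Icc 1 N, ratioResidue (lambertRatio X) (Icc 1 N) j ^ 3 *
    (lambert X j ^ (k + 1) * cayley X j ^ 2)

lemma nodeRatios_lambert_X (R : Type*) [CommRing R] [IsDomain R] (N : ℕ) :
    NodeRatios (lambert (X : R⟦X⟧)) (lambertRatio X) (Icc 1 N) :=
  (isQBase_X R).nodeRatios X_ne_zero (by simp)

lemma modX_ratioResidue_sq_mul {j : ℕ} (hj : j ≠ 0) (t : ℕ) :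
    modX R (t + 1) (ratioResidue (lambertRatio X) (Icc 1 (j + t)) j ^ 2) =
      modX R (t + 1) ((X : R⟦X⟧) ^ (j * (j - 1)) * (1 + X ^ j) ^ 2) := by
  have hsq := congrArg (modX R (t + 1)) ((isQBase_X R).ratioResidue_sq_mul hj t)
  have hN := modX_qPoch_add (R := R) t j
  rw [add_comm t j] at hN
  have hunit : IsUnit (modX R (t + 1) (qPoch X X t) ^ 4) := ((isUnit_qPoch t).map _).pow 4
  apply hunit.mul_right_cancel
  simp only [map_mul, map_pow, map_add, map_one, hN, modX_qPoch_add] at hsq ⊢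
  rw [← hsq]
  ring

lemma modX_ratioResidue_sq_mul_lambert {j : ℕ} (hj : j ≠ 0) (t : ℕ) :
    modX R (t + 1) (ratioResidue (lambertRatio X) (Icc 1 (j + t)) j ^ 2 *
      (lambert X j * cayley X j ^ 2)) = modX R (t + 1) (X ^ j ^ 2) := by
  have hcancel : lambert (X : R⟦X⟧) j * cayley X j ^ 2 * (1 + X ^ j) ^ 2 = X ^ j := by
    rw [mul_assoc, ← mul_pow, (isQBase_X R).cayley_mul_one_add hj, lambert, mul_assoc, ← mul_pow,
      (isQBase_X R).invOneSub_mul hj, one_pow, mul_one]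
  have hexp : j ^ 2 = j * (j - 1) + j := by
    rw [Nat.mul_sub_one, Nat.sub_add_cancel (Nat.le_mul_self j), sq]
  rw [map_mul, modX_ratioResidue_sq_mul hj, ← map_mul, hexp, pow_add X (j * _)]
  congr 1
  linear_combination (X : R⟦X⟧) ^ (j * (j - 1)) * hcancel

lemma modX_sum_qPoch_mul_lambert_mul_hsymm [IsDomain R] {N : ℕ} (hN : 1 ≤ N) :
    modX R (N + 1) (∑ n ∈ Icc 1 N, qPoch X X n * lambert X n * hsymm (lambert X) (Icc n N) 3) =
      modX R (N + 1) (hsymm (lambert X) (Icc 1 N) 4 - cubicSum R N 4) := by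
  rw [(isQBase_X R).sum_qPoch_mul_lambert_mul_hsymm X_ne_zero,
    ← (nodeRatios_lambert_X R N).sum_ratioResidue_mul_pow (nonempty_Icc.2 hN), cubicSum,
    ← sum_sub_distrib, map_sum, map_sum]
  refine sum_congr rfl fun j hj => ?_
  obtain ⟨hj1, hjN⟩ := mem_Icc.1 hj
  have hj0 : j ≠ 0 := by omega
  obtain ⟨t, rfl⟩ := Nat.exists_eq_add_of_le hjN
  have hterm := modX_mul_left (R := R) (M' := j + t + 1) (i := j * 4)
    (c := ratioResidue (lambertRatio X) (Icc 1 (j + t)) j * lambert X j ^ 4)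
    ((X_pow_dvd_lambert_pow j 4).mul_left _)
    (modX_ratioResidue_sq_mul_lambert hj0 t) (by omega)
  rw [mul_sub, mul_one, map_sub, ← hterm, ← map_sub]
  ring_nf

variable [CharP R 3]

lemma cubicSum_succ_add (N k : ℕ) :
    cubicSum R N (k + 1) + cubicSum R N k =
      ∑ j ∈ Icc 1 N, ratioResidue (lambertRatio X) (Icc 1 N) j ^ 3 * lambert X j ^ (k + 1) := by
  rw [cubicSum, cubicSum, ← sum_add_distrib]
  refine sum_congr rfl fun j hj => ?_
  rw [mem_Icc] at hj
  linear_combination ratioResidue (lambertRatio X) (Icc 1 N) j ^ 3 * lambert X j ^ (k + 1) *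
    (isQBase_X R).one_add_lambert_mul_cayley_sq (j := j) (by omega)

variable [IsDomain R] {N : ℕ}

lemma cubicSum_three_add_two (hN : 1 ≤ N) :
    cubicSum R N 3 + cubicSum R N 2 = psum (lambert X) (Icc 1 N) 1 ^ 3 := by
  rw [cubicSum_succ_add,
    (nodeRatios_lambert_X R N).sum_ratioResidue_cube_mul_cube (nonempty_Icc.2 hN)]

lemma modX_cubicSum_two (hN : 1 ≤ N) :
    modX R (N + 1) (cubicSum R N 2 + (eulerD R (cubicSum R N 1) +
      psum (lambert X) (Icc 1 N) 1 * cubicSum R N 1)) =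
      modX R (N + 1) (2 * psum (lambert X) (Icc 1 N) 2) := by
  have h3 : (3 : R⟦X⟧) = 0 := CharP.ofNat_eq_zero R⟦X⟧ 3
  rw [← (nodeRatios_lambert_X R N).sum_ratioResidue_cube_mul_sq (nonempty_Icc.2 hN), cubicSum,
    cubicSum, map_sum (eulerD R), mul_sum, mul_sum, ← sum_add_distrib, ← sum_add_distrib, map_sum,
    map_sum]
  refine sum_congr rfl fun j hj => ?_
  obtain ⟨hj1, hjN⟩ := mem_Icc.1 hj
  have hj0 : j ≠ 0 := by omega
  obtain ⟨t, rfl⟩ := Nat.exists_eq_add_of_le hjN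
  have hterm := modX_mul_left (R := R) (M' := j + t + 1) (i := j * 2)
    (c := ratioResidue (lambertRatio X) (Icc 1 (j + t)) j ^ 3 * lambert X j ^ 2)
    ((X_pow_dvd_lambert_pow j 2).mul_left _)
    (modX_two_sub_sum_lambertRatio_sq hj0 t) (by omega)
  rw [eulerD_cube_mul, (isQBase_X R).derivation_lambert_sq_mul_cayley_sq (eulerD R) eulerD_X hj0]
  convert! hterm.symm using 2
  · ring
  · linear_combination ratioResidue (lambertRatio X) (Icc 1 (j + t)) j ^ 3 * lambert X j ^ 2 *
      (∑ m ∈ (Icc 1 (j + t)).erase j, lambertRatio X j m ^ 2) * h3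

lemma modX_cubicSum_four (hN : 1 ≤ N) :
    modX R (N + 1) (cubicSum R N 4 + cubicSum R N 3 + (eulerD R (cubicSum R N 3) +
      psum (lambert X) (Icc 1 N) 1 * cubicSum R N 3)) =
      modX R (N + 1) (psum (lambert X) (Icc 1 N) 4 + psum (lambert X) (Icc 1 N) 1 ^ 4) := by
  have h3 : (3 : R⟦X⟧) = 0 := CharP.ofNat_eq_zero R⟦X⟧ 3
  rw [← (nodeRatios_lambert_X R N).sum_ratioResidue_cube_mul_pow_four (nonempty_Icc.2 hN),
    cubicSum_succ_add, cubicSum, map_sum (eulerD R), mul_sum, ← sum_add_distrib,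
    ← sum_add_distrib, map_sum, map_sum]
  refine sum_congr rfl fun j hj => ?_
  obtain ⟨hj1, hjN⟩ := mem_Icc.1 hj
  have hj0 : j ≠ 0 := by omega
  obtain ⟨t, rfl⟩ := Nat.exists_eq_add_of_le hjN
  have hterm := modX_mul_left (R := R) (M' := j + t + 1) (i := j * 4)
    (c := ratioResidue (lambertRatio X) (Icc 1 (j + t)) j ^ 3 * lambert X j ^ 4)
    ((X_pow_dvd_lambert_pow j 4).mul_left _)
    (modX_one_add_sum_lambertRatio_sub_sq hj0 t) (by omega)
  rw [eulerD_cube_mul, pow_succ (lambert X j) 3, mul_assoc (lambert X j ^ 3), eulerD_cube_mul,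
    (isQBase_X R).derivation_lambert_mul_cayley_sq (eulerD R) eulerD_X hj0]
  set r := ratioResidue (lambertRatio (X : R⟦X⟧)) (Icc 1 (j + t)) j
  trans modX R (j + t + 1) (r ^ 3 * lambert X j ^ 4 + r ^ 3 * lambert X j ^ 4 *
    ((j : R⟦X⟧) * cayley X j ^ 3 + psum (lambert X) (Icc 1 (j + t)) 1 * cayley X j ^ 2))
  · ring_nf
  rw [map_add, ← hterm, ← map_add]
  congr 1
  linear_combination r ^ 3 * lambert X j ^ 4 * h3

end CubicSums

section ThetaSums

variable {R : Type*} [CommRing R] {N : ℕ}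

lemma qPoch_sq_mul_signedEsymm_lambert (R : Type*) [CommRing R] (N k : ℕ) :
    qPoch (X : R⟦X⟧) X N ^ 2 * signedEsymm (lambert X) (Icc 1 N) k =
      ∑ n ∈ range (N + 1), tripleCoeff X N n * (thetaCoeff n k : R⟦X⟧) := by
  have hprod : ∏ m ∈ Icc 1 N, (C ((1 - (X : R⟦X⟧) ^ m) ^ 2) - C (X ^ m) * X : R⟦X⟧⟦X⟧) =
      C (qPoch X X N ^ 2) * ∏ m ∈ Icc 1 N, (1 - C (lambert X m) * X) := by
    rw [qPoch_self_eq_prod_Icc, ← prod_pow, map_prod, ← prod_mul_distrib]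
    refine prod_congr rfl fun m hm => ?_
    have hfactor : (1 - (X : R⟦X⟧) ^ m) ^ 2 * lambert X m = X ^ m := by
      have hm0 : m ≠ 0 := by rw [mem_Icc] at hm; omega
      rw [lambert, mul_left_comm, ← mul_pow, mul_comm (1 - _), (isQBase_X R).invOneSub_mul hm0,
        one_pow, mul_one]
    rw [mul_sub, mul_one, ← mul_assoc, ← map_mul, hfactor]
  rw [signedEsymm, ← coeff_C_mul, ← hprod, prod_Icc_eq_sum_tripleCoeff, map_sum]
  simp only [coeff_C_mul, theta, coeff_mk]

lemma modX_qPoch_mul_qBinom {n : ℕ} (hn : n ≤ N) :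
    modX R (N - n + 1) (qPoch X X N * qBinom X (2 * N + 1) (N + n + 1)) =
      modX R (N - n + 1) 1 := by
  have hmod (K : ℕ) (hK : N - n ≤ K) :
      modX R (N - n + 1) (qPoch X X K) = modX R (N - n + 1) (qPoch X X (N - n)) := by
    obtain ⟨d, rfl⟩ := Nat.exists_eq_add_of_le hK
    exact modX_qPoch_add _ _
  have h := congrArg (modX R (N - n + 1))
    (qBinom_mul_qPoch_mul_qPoch (X : R⟦X⟧) (N + n + 1) (N - n))
  rw [show N + n + 1 + (N - n) = 2 * N + 1 by omega, map_mul, map_mul, hmod (2 * N + 1) (by omega),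
    hmod (N + n + 1) (by omega)] at h
  apply ((isUnit_qPoch (N - n)).map (modX R (N - n + 1))).mul_right_cancel
  rw [map_mul, hmod N (by omega), map_one, one_mul, mul_comm (modX R _ _) (modX R _ (qBinom _ _ _)),
    h]

lemma modX_qPoch_mul_tripleCoeff {n : ℕ} (hn : n ≤ N) :
    modX R (N + 1) (qPoch X X N * tripleCoeff X N n) =
      modX R (N + 1) ((-1) ^ n * X ^ (n + 1).choose 2) := by
  have hle : n ≤ (n + 1).choose 2 := by
    rw [Nat.choose_succ_succ', Nat.choose_one_right]
    exact Nat.le_add_right _ _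
  have h := modX_mul_left (c := (-1) ^ n * (X : R⟦X⟧) ^ (n + 1).choose 2) (M' := N + 1)
    (Dvd.intro_left _ rfl) (modX_qPoch_mul_qBinom hn) (by omega)
  rw [mul_one] at h
  rw [← h, tripleCoeff]
  ring_nf

/-- The theta series `∑ (-1) ^ n a n q ^ (n (n + 1) / 2)`, truncated at `n = N`, where `a n` is the
coefficient of degree `k` of `θ_n`. -/
noncomputable def thetaSum (R : Type*) [CommRing R] (N k : ℕ) : R⟦X⟧ :=
  ∑ n ∈ range (N + 1), C ((-1) ^ n * (thetaCoeff n k : R)) * X ^ (n + 1).choose 2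

lemma modX_qPoch_cube_mul_signedEsymm (R : Type*) [CommRing R] (N k : ℕ) :
    modX R (N + 1) (qPoch X X N ^ 3 * signedEsymm (lambert X) (Icc 1 N) k) =
      modX R (N + 1) (thetaSum R N k) := by
  rw [pow_succ' (qPoch X X N) 2, mul_assoc, qPoch_sq_mul_signedEsymm_lambert, mul_sum, thetaSum,
    map_sum, map_sum]
  refine sum_congr rfl fun n hn => ?_
  rw [← mul_assoc, map_mul, modX_qPoch_mul_tripleCoeff (by rw [mem_range] at hn; omega), ← map_mul]
  simp only [map_mul, map_pow, map_neg, map_one, map_natCast]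
  ring

lemma eulerD_thetaSum (N k : ℕ) : eulerD R (thetaSum R N k) = ∑ n ∈ range (N + 1),
    C ((-1) ^ n * ((n + 1).choose 2 * thetaCoeff n k : R)) * X ^ (n + 1).choose 2 := by
  rw [thetaSum, map_sum]
  refine sum_congr rfl fun n _ => ?_
  rw [← smul_eq_C_mul, Derivation.map_smul, derivation_pow_self (eulerD R) eulerD_X, smul_eq_C_mul]
  simp only [map_mul, map_natCast]
  ring

variable [CharP R 3]

lemma thetaSum_two (N : ℕ) : thetaSum R N 2 = eulerD R (thetaSum R N 1) - thetaSum R N 1 := by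
  rw [eulerD_thetaSum, thetaSum, thetaSum, ← sum_sub_distrib]
  refine sum_congr rfl fun n _ => ?_
  rw [thetaCoeff_two, ← sub_mul, ← map_sub]
  congr 2
  ring

lemma eulerD_thetaSum_two (N : ℕ) : eulerD R (thetaSum R N 2) = 0 := by
  simp only [eulerD_thetaSum, choose_mul_thetaCoeff_two, mul_zero, map_zero, zero_mul,
    sum_const_zero]

lemma eulerD_thetaSum_three (N : ℕ) : eulerD R (thetaSum R N 3) = 0 := by
  simp only [eulerD_thetaSum, choose_mul_thetaCoeff_three, mul_zero, map_zero, zero_mul,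
    sum_const_zero]

end ThetaSums

section SymmetricDerivatives

variable {R : Type*} [CommRing R]

lemma modX_X_pow_mul_invOneSub {m : ℕ} (hm : m ≠ 0) (N : ℕ) :
    modX R (N + 1) (X ^ m * invOneSub X m) = modX R (N + 1) (∑ r ∈ Icc 1 N, X ^ (m * r)) := by
  have hsum (K : ℕ) : ∑ r ∈ Icc 1 K, (X : R⟦X⟧) ^ (m * r) =
      (X ^ m - X ^ (m * (K + 1))) * invOneSub X m := by
    induction K with
    | zero => simp
    | succ K ih =>
      rw [sum_Icc_succ_top (by omega), ih]
      linear_combination (-(X ^ (m * (K + 1)))) * (isQBase_X R).invOneSub_mul hm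
  rw [modX_eq_iff, hsum, ← sub_mul, sub_sub_cancel]
  exact (pow_dvd_pow X (Nat.le_mul_of_pos_left _ (by omega))).mul_right _

lemma modX_lambert_eq_sum {m : ℕ} (hm : m ≠ 0) (N : ℕ) :
    modX R (N + 1) (lambert X m) = modX R (N + 1) (∑ r ∈ Icc 1 N, (r : R⟦X⟧) * X ^ (m * r)) := by
  have hsum (K : ℕ) : ∑ r ∈ Icc 1 K, (r : R⟦X⟧) * X ^ (m * r) =
      lambert (X : R⟦X⟧) m -
        X ^ (m * (K + 1)) * (((K : R⟦X⟧) + 1 - (K : R⟦X⟧) * X ^ m) * invOneSub X m ^ 2) := by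
    induction K with
    | zero => simp [lambert]
    | succ K ih =>
      rw [sum_Icc_succ_top (by omega), ih]
      push_cast
      linear_combination (-((K + 1) * (X : R⟦X⟧) ^ (m * (K + 1)) *
        (invOneSub X m * (1 - X ^ m) + 1))) *
        (isQBase_X R).invOneSub_mul hm
  rw [modX_eq_iff, hsum, sub_sub_cancel]
  exact (pow_dvd_pow X (Nat.le_mul_of_pos_left _ (by omega))).mul_right _

lemma modX_sum_mul_X_pow_mul_invOneSub (R : Type*) [CommRing R] (N : ℕ) :
    modX R (N + 1) (∑ m ∈ Icc 1 N, (m : R⟦X⟧) * (X ^ m * invOneSub X m)) =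
      modX R (N + 1) (psum (lambert X) (Icc 1 N) 1) := by
  have hleft : modX R (N + 1) (∑ m ∈ Icc 1 N, (m : R⟦X⟧) * (X ^ m * invOneSub X m)) =
      modX R (N + 1) (∑ m ∈ Icc 1 N, ∑ r ∈ Icc 1 N, (m : R⟦X⟧) * X ^ (m * r)) := by
    rw [map_sum, map_sum]
    refine sum_congr rfl fun m hm => ?_
    rw [map_mul, modX_X_pow_mul_invOneSub (by rw [mem_Icc] at hm; omega), ← map_mul, mul_sum]
  rw [hleft, sum_comm, psum, map_sum, map_sum]
  refine sum_congr rfl fun r hr => ?_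
  rw [pow_one, modX_lambert_eq_sum (by rw [mem_Icc] at hr; omega)]
  simp only [mul_comm r]

/-- The generating function `∏ 1 / (1 - q ^ m)` of the partitions into parts at most `N`. -/
noncomputable def partsProd (R : Type*) [CommRing R] (N : ℕ) : R⟦X⟧ :=
  ∏ m ∈ Icc 1 N, invOneSub X m

lemma partsProd_mul_qPoch (N : ℕ) : partsProd R N * qPoch X X N = 1 := by
  rw [partsProd, qPoch_self_eq_prod_Icc, ← prod_mul_distrib]
  refine prod_eq_one fun m hm => (isQBase_X R).invOneSub_mul ?_
  rw [mem_Icc] at hm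
  omega

lemma modX_eulerD_partsProd (N : ℕ) : modX R (N + 1) (eulerD R (partsProd R N)) =
    modX R (N + 1) (partsProd R N * psum (lambert X) (Icc 1 N) 1) := by
  rw [map_mul, ← modX_sum_mul_X_pow_mul_invOneSub, ← map_mul, partsProd,
    derivation_prod_eq_prod_mul_sum]
  intro m hm
  rw [(isQBase_X R).derivation_invOneSub (eulerD R) eulerD_X (by rw [mem_Icc] at hm; omega),
    lambert]
  ring

lemma modX_qPoch_cube_cancel {M N : ℕ} {a b : R⟦X⟧}
    (h : modX R M (qPoch X X N ^ 3 * a) = modX R M (qPoch X X N ^ 3 * b)) :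
    modX R M a = modX R M b := by
  rw [map_mul, map_mul] at h
  exact (((isUnit_qPoch N).pow 3).map (modX R M)).mul_left_cancel h

lemma eulerD_eulerD_eulerD [CharP R 3] (f : R⟦X⟧) : eulerD R (eulerD R (eulerD R f)) =
    eulerD R f := by
  ext n
  simp only [coeff_eulerD]
  have hcube : (n : R) ^ 3 = n := by
    have h := congrArg (ZMod.castHom (dvd_refl 3) R) (ZMod.pow_card (n : ZMod 3))
    simpa only [map_pow, map_natCast] using h
  linear_combination coeff n f * hcube

lemma modX_eulerD_signedEsymm_two (R : Type*) [CommRing R] [CharP R 3] (N : ℕ) :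
    modX R (N + 1) (eulerD R (signedEsymm (lambert X) (Icc 1 N) 2)) = modX R (N + 1) 0 := by
  apply modX_qPoch_cube_cancel (N := N)
  rw [← eulerD_cube_mul, modX_eulerD (modX_qPoch_cube_mul_signedEsymm R N 2), eulerD_thetaSum_two,
    mul_zero]

lemma modX_eulerD_signedEsymm_three (R : Type*) [CommRing R] [CharP R 3] (N : ℕ) :
    modX R (N + 1) (eulerD R (signedEsymm (lambert X) (Icc 1 N) 3)) = modX R (N + 1) 0 := by
  apply modX_qPoch_cube_cancel (N := N)
  rw [← eulerD_cube_mul, modX_eulerD (modX_qPoch_cube_mul_signedEsymm R N 3), eulerD_thetaSum_three,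
    mul_zero]

lemma modX_eulerD_psum_one (R : Type*) [CommRing R] [CharP R 3] (N : ℕ) :
    modX R (N + 1) (eulerD R (psum (lambert X) (Icc 1 N) 1)) =
      modX R (N + 1) (psum (lambert X) (Icc 1 N) 1 - signedEsymm (lambert X) (Icc 1 N) 2) := by
  have h : modX R (N + 1) (signedEsymm (lambert X) (Icc 1 N) 2) = modX R (N + 1)
      (eulerD R (signedEsymm (lambert X) (Icc 1 N) 1) - signedEsymm (lambert X) (Icc 1 N) 1) := by
    apply modX_qPoch_cube_cancel (N := N)
    rw [modX_qPoch_cube_mul_signedEsymm, thetaSum_two, mul_sub, ← eulerD_cube_mul, map_sub, map_sub,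
      modX_eulerD (modX_qPoch_cube_mul_signedEsymm R N 1), modX_qPoch_cube_mul_signedEsymm]
  rw [signedEsymm_one, map_neg] at h
  simp only [map_sub, map_neg] at h ⊢
  linear_combination h

lemma modX_signedEsymm_two (R : Type*) [CommRing R] [CharP R 3] (N : ℕ) :
    modX R (N + 1) (signedEsymm (lambert X) (Icc 1 N) 2) =
      modX R (N + 1) (psum (lambert X) (Icc 1 N) 1 ^ 3) := by
  have h1 := modX_eulerD_partsProd (R := R) N
  have h3 : modX R (N + 1) 3 = 0 := by rw [CharP.ofNat_eq_zero R⟦X⟧ 3, map_zero]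
  have hp := modX_eulerD_psum_one R N
  have hE := modX_eulerD_signedEsymm_two R N
  set F := partsProd R N
  set p := psum (lambert (X : R⟦X⟧)) (Icc 1 N) 1
  set E := signedEsymm (lambert (X : R⟦X⟧)) (Icc 1 N) 2
  have h2 : modX R (N + 1) (eulerD R (eulerD R F)) = modX R (N + 1) (F * (p ^ 2 + p - E)) := by
    rw [modX_eulerD h1, eulerD_mul, map_add, map_mul, hp, map_mul _ p, h1]
    simp only [map_mul, map_add, map_sub, map_pow]
    ring
  -- Three applications of the Euler operator to `F` amount to a single one.
  have h := modX_eulerD h2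
  rw [eulerD_eulerD_eulerD, h1, eulerD_mul, map_sub (eulerD R), map_add (eulerD R), sq p,
    eulerD_mul] at h
  simp only [map_mul, map_add, map_sub, hp, hE, h1, map_zero, map_ofNat] at h h3
  apply ((IsUnit.of_mul_eq_one _ (partsProd_mul_qPoch (R := R) N)).map
    (modX R (N + 1))).mul_left_cancel
  rw [map_pow]
  linear_combination h + modX R (N + 1) F * (modX R (N + 1) p ^ 2 -
    modX R (N + 1) p * modX R (N + 1) E) * h3

end SymmetricDerivatives

section EulerDerivative

variable {R : Type*} [CommRing R]

lemma modX_eulerD_partsProd_mul (N : ℕ) (f : R⟦X⟧) :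
    modX R (N + 1) (eulerD R (partsProd R N * f)) = modX R (N + 1)
      (partsProd R N * (eulerD R f + psum (lambert X) (Icc 1 N) 1 * f)) := by
  rw [eulerD_mul, map_add, map_mul _ f, modX_eulerD_partsProd]
  simp only [map_mul, map_add]
  ring

/-- A polynomial in the symmetric functions of the Lambert nodes: up to the factor `partsProd R N`,
a primitive of the part of the generating function that is left over by the cubic sums. -/
noncomputable def nodePrimitive (R : Type*) [CommRing R] (N : ℕ) : R⟦X⟧ :=
  psum (lambert X) (Icc 1 N) 1 ^ 3 * (psum (lambert X) (Icc 1 N) 1 + 1) +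
    psum (lambert X) (Icc 1 N) 1 - 1 - signedEsymm (lambert X) (Icc 1 N) 3

/-- The generating function of `spt (k + 1)`, correct up to degree `N`. -/
noncomputable def sptSeries (R : Type*) [CommRing R] (N k : ℕ) : R⟦X⟧ :=
  partsProd R N * ∑ n ∈ Icc 1 N, qPoch X X n * lambert X n * hsymm (lambert X) (Icc n N) k

variable [CharP R 3]

lemma modX_hsymm_four_sub (R : Type*) [CommRing R] [CharP R 3] (N : ℕ) :
    modX R (N + 1) (hsymm (lambert X) (Icc 1 N) 4 - 2 * psum (lambert X) (Icc 1 N) 2 -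
      psum (lambert X) (Icc 1 N) 4 - psum (lambert X) (Icc 1 N) 1 ^ 4 +
        psum (lambert X) (Icc 1 N) 1 ^ 3) =
      modX R (N + 1) (eulerD R (nodePrimitive R N) +
        psum (lambert X) (Icc 1 N) 1 * nodePrimitive R N) := by
  have h3 : modX R (N + 1) 3 = 0 := by rw [CharP.ofNat_eq_zero R⟦X⟧ 3, map_zero]
  have hpsum : psum (lambert (X : R⟦X⟧)) (Icc 1 N) 3 = psum (lambert X) (Icc 1 N) 1 ^ 3 := by
    simp only [psum, pow_one, sum_pow_char 3]
  have hnewton := congrArg (modX R (N + 1)) (four_mul_hsymm_four (lambert (X : R⟦X⟧)) (Icc 1 N))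
  rw [hsymm_two, hsymm_three, psum_two, hpsum] at hnewton
  have hp := modX_eulerD_psum_one R N
  have hE2 := modX_signedEsymm_two R N
  have hE3 := modX_eulerD_signedEsymm_three R N
  rw [psum_two, nodePrimitive, map_sub (eulerD R), map_sub (eulerD R), map_add (eulerD R),
    eulerD_cube_mul, map_add (eulerD R), Derivation.map_one_eq_zero]
  simp only [map_mul, map_add, map_sub, map_pow, map_ofNat, map_one, map_zero, hp, hE2, hE3]
    at hnewton h3 ⊢
  set p := modX R (N + 1) (psum (lambert (X : R⟦X⟧)) (Icc 1 N) 1)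
  linear_combination hnewton + (p ^ 6 - 2 * p ^ 5 + 2 * p ^ 3 - p ^ 2 -
    modX R (N + 1) (hsymm (lambert X) (Icc 1 N) 4)) * h3

lemma modX_eulerD_cubicSum [IsDomain R] {N : ℕ} (hN : 1 ≤ N) :
    modX R (N + 1) (eulerD R (cubicSum R N 1 + cubicSum R N 3) +
      psum (lambert X) (Icc 1 N) 1 * (cubicSum R N 1 + cubicSum R N 3)) =
      modX R (N + 1) (2 * psum (lambert X) (Icc 1 N) 2 + psum (lambert X) (Icc 1 N) 4 +
        psum (lambert X) (Icc 1 N) 1 ^ 4 - psum (lambert X) (Icc 1 N) 1 ^ 3 - cubicSum R N 4) := by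
  have h2 := modX_cubicSum_two (R := R) hN
  have h4 := modX_cubicSum_four (R := R) hN
  have h32 := congrArg (modX R (N + 1)) (cubicSum_three_add_two (R := R) hN)
  rw [map_add (eulerD R)]
  simp only [map_add, map_sub, map_mul] at h2 h4 h32 ⊢
  linear_combination h2 + h4 - h32

lemma exists_modX_sptSeries_three_eq_eulerD [IsDomain R] {N : ℕ} (hN : 1 ≤ N) :
    ∃ G : R⟦X⟧, modX R (N + 1) (sptSeries R N 3) = modX R (N + 1) (eulerD R G) := by
  have hsum := modX_sum_qPoch_mul_lambert_mul_hsymm (R := R) hN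
  have hcubic := modX_eulerD_cubicSum (R := R) hN
  have hsymm := modX_hsymm_four_sub R N
  refine ⟨partsProd R N * (cubicSum R N 1 + cubicSum R N 3 + nodePrimitive R N), ?_⟩
  rw [sptSeries, modX_eulerD_partsProd_mul, map_mul, hsum, map_mul, map_add (eulerD R)]
  simp only [map_add, map_sub, map_mul] at hcubic hsymm ⊢
  linear_combination modX R (N + 1) (partsProd R N) * (hsymm - hcubic)

lemma coeff_three_mul_sptSeries_three [IsDomain R] {N n : ℕ} (hN : 1 ≤ N) (hn : 3 * n ≤ N) :
    coeff (3 * n) (sptSeries R N 3) = 0 := by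
  obtain ⟨G, hG⟩ := exists_modX_sptSeries_three_eq_eulerD (R := R) hN
  rw [coeff_eq_of_modX_eq hG (by omega), coeff_eulerD, Nat.cast_mul, Nat.cast_ofNat,
    CharP.ofNat_eq_zero R 3, zero_mul, zero_mul]

end EulerDerivative

section Spread

variable {k d : ℕ} {m m' : Composition k} {j : Fin m.length → Fin d} {j' : Fin m'.length → Fin d}

/-- The multiplicity function on `Fin d` which places the blocks of a composition at the
indices `j`. -/
def spread (m : Composition k) (j : Fin m.length → Fin d) (t : Fin d) : ℕ :=
  ∑ i, if j i = t then m.blocksFun i else 0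

lemma spread_apply (hj : StrictMono j) (i : Fin m.length) :
    spread m j (j i) = m.blocksFun i := by
  rw [spread, sum_eq_single i (fun b _ hb => if_neg (hj.injective.ne hb)) (by simp), if_pos rfl]

lemma spread_eq_zero {t : Fin d} (ht : ∀ i, j i ≠ t) : spread m j t = 0 :=
  sum_eq_zero fun i _ => if_neg (ht i)

lemma spread_ne_zero_iff (hj : StrictMono j) {t : Fin d} :
    spread m j t ≠ 0 ↔ t ∈ univ.image j := by
  simp only [mem_image, mem_univ, true_and]
  refine ⟨not_imp_comm.1 fun ht => spread_eq_zero (not_exists.1 ht), ?_⟩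
  rintro ⟨i, rfl⟩
  rw [spread_apply hj]
  exact (m.blocks_pos' _ i.2).ne'

lemma sum_spread (m : Composition k) (j : Fin m.length → Fin d) : ∑ t, spread m j t = k := by
  simp only [spread]
  rw [sum_comm]
  simp [m.sum_blocksFun]

lemma prod_spread {R : Type*} [CommMonoid R] (hj : StrictMono j) (P : Fin d → ℕ → R)
    (hP : ∀ t, (∀ i, j i ≠ t) → P t 0 = 1) :
    ∏ t, P t (spread m j t) = ∏ i, P (j i) (m.blocksFun i) := by
  rw [← prod_subset (subset_univ (univ.image j)), prod_image hj.injective.injOn]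
  · exact prod_congr rfl fun i _ => by rw [spread_apply hj]
  · intro t _ ht
    have ht' : ∀ i, j i ≠ t := fun i hi => ht (mem_image.2 ⟨i, mem_univ i, hi⟩)
    rw [spread_eq_zero ht', hP t ht']

lemma exists_eq_comp_cast_of_spread_eq (hj : StrictMono j) (hj' : StrictMono j')
    (h : spread m j = spread m' j') :
    ∃ hlen : m.length = m'.length, ∀ i, j i = j' (Fin.cast hlen i) := by
  have himage : univ.image j = univ.image j' := by
    ext t
    rw [← spread_ne_zero_iff hj, ← spread_ne_zero_iff hj', h]
  have hcard : (univ.image j).card = m.length := by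
    rw [card_image_of_injective _ hj.injective, card_univ, Fintype.card_fin]
  have hcard' : (univ.image j).card = m'.length := by
    rw [himage, card_image_of_injective _ hj'.injective, card_univ, Fintype.card_fin]
  have hunique := orderEmbOfFin_unique hcard (fun i => mem_image_of_mem j (mem_univ i)) hj
  have hunique' := orderEmbOfFin_unique hcard'
    (fun i => himage ▸ mem_image_of_mem j' (mem_univ i)) hj'
  refine ⟨hcard.symm.trans hcard', fun i => ?_⟩
  rw [congrFun hunique i, congrFun hunique' (Fin.cast _ i), orderEmbOfFin_eq_orderEmbOfFin_iff]
  rfl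

lemma spread_injective (hj : StrictMono j) (hj' : StrictMono j')
    (h : spread m j = spread m' j') :
    (⟨m, j⟩ : Σ m : Composition k, Fin m.length → Fin d) = ⟨m', j'⟩ := by
  obtain ⟨hlen, hjj'⟩ := exists_eq_comp_cast_of_spread_eq hj hj' h
  obtain rfl : m = m' := by
    apply Composition.ext
    rw [← m.ofFn_blocksFun, ← m'.ofFn_blocksFun, List.ofFn_congr hlen]
    congr 1
    funext i
    rw [← spread_apply hj, ← spread_apply hj', h, hjj']
    rfl
  congr 1
  exact funext hjj'

lemma exists_composition_blocksFun_eq {f : Fin d → ℕ} (hf : ∀ i, 0 < f i) (hk : ∑ i, f i = k) :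
    ∃ (m : Composition k) (hm : m.length = d), ∀ i, m.blocksFun i = f (Fin.cast hm i) := by
  refine ⟨⟨List.ofFn f, fun hx => ?_, by rw [List.sum_ofFn, hk]⟩, List.length_ofFn,
    fun i => List.get_ofFn f i⟩
  obtain ⟨i, rfl⟩ := (List.mem_ofFn' _ _).1 hx
  exact hf i

lemma exists_spread_eq (g : Fin d → ℕ) (hg : ∑ t, g t = k) :
    ∃ (m : Composition k) (j : Fin m.length → Fin d), StrictMono j ∧ spread m j = g := by
  set s : Finset (Fin d) := univ.filter fun t => g t ≠ 0 with hs
  have hsum : ∑ i, g (s.orderEmbOfFin rfl i) = k := by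
    rw [← hg, ← sum_filter_ne_zero (s := univ) (f := g), ← hs, ← sum_coe_sort s g]
    exact Fintype.sum_equiv (s.orderIsoOfFin rfl).toEquiv _ _ (fun i => rfl)
  have hpos (i) : 0 < g (s.orderEmbOfFin rfl i) :=
    Nat.pos_of_ne_zero (mem_filter.1 (s.orderEmbOfFin_mem rfl i)).2
  obtain ⟨m, hlen, hblocks⟩ := exists_composition_blocksFun_eq hpos hsum
  have hj : StrictMono fun i : Fin m.length => s.orderEmbOfFin rfl (Fin.cast hlen i) :=
    (s.orderEmbOfFin rfl).strictMono.comp (Fin.cast_strictMono hlen)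
  refine ⟨m, _, hj, funext fun t => ?_⟩
  by_cases ht : g t = 0
  · rw [ht]
    exact spread_eq_zero fun i hi => (hpos (Fin.cast hlen i)).ne' (hi ▸ ht)
  · obtain ⟨i, rfl⟩ : t ∈ Set.range (s.orderEmbOfFin rfl) := by
      rw [range_orderEmbOfFin]
      simp [hs, ht]
    exact (spread_apply hj (Fin.cast hlen.symm i)).trans (hblocks _)

lemma sum_composition_prod_spread {R : Type*} [CommSemiring R] (P : Fin d → ℕ → R) (k : ℕ) :
    ∑ m : Composition k, ∑ j : Fin m.length → Fin d with StrictMono j,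
      ∏ t, P t (spread m j t) = coeff k (∏ t, mk (P t)) := by
  rw [sum_sigma', coeff_prod]
  refine sum_bij (fun x _ => Finsupp.equivFunOnFinite.symm (spread x.1 x.2)) ?_ ?_ ?_ ?_
  · rintro ⟨m, j⟩ -
    simp [mem_finsuppAntidiag, sum_spread]
  · rintro ⟨m, j⟩ h ⟨m', j'⟩ h' e
    simp only [mem_sigma, mem_filter, mem_univ, true_and] at h h'
    exact spread_injective h h' (Finsupp.equivFunOnFinite.symm.injective e)
  · intro g hg
    obtain ⟨m, j, hj, e⟩ := exists_spread_eq g (mem_finsuppAntidiag.1 hg).1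
    refine ⟨⟨m, j⟩, by simpa using hj, ?_⟩
    ext t
    simp [e]
  · rintro ⟨m, j⟩ -
    simp

end Spread

section Weight

/-- The factor contributed to the weight by a smallest part which occurs `c` times and carries
the block `m` of the composition; it vanishes for `m = 0` because every composition has a block
at the smallest part. -/
def smallestFactor (c m : ℕ) : ℕ := if m = 0 then 0 else (c + m - 1).choose (2 * m - 1)

/-- The factor contributed to the weight by a part which occurs `c` times, is not smallest and
carries the block `m` of the composition, with `m = 0` when it carries no block. -/
def otherFactor (c m : ℕ) : ℕ := (c + m).choose (2 * m)

lemma smallestFactor_zero_right (c : ℕ) : smallestFactor c 0 = 0 := if_pos rfl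

lemma smallestFactor_of_ne_zero (c : ℕ) {m : ℕ} (hm : m ≠ 0) :
    smallestFactor c m = (c + m - 1).choose (2 * m - 1) := if_neg hm

lemma smallestFactor_zero_left (m : ℕ) : smallestFactor 0 m = 0 := by
  rcases eq_or_ne m 0 with rfl | hm
  · exact smallestFactor_zero_right 0
  · rw [smallestFactor_of_ne_zero _ hm, Nat.choose_eq_zero_of_lt (by lia)]

lemma otherFactor_zero_right (c : ℕ) : otherFactor c 0 = 1 := by
  rw [otherFactor, mul_zero, Nat.choose_zero_right]

lemma otherFactor_zero_left (m : ℕ) : otherFactor 0 m = if m = 0 then 1 else 0 := by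
  split_ifs with hm
  · rw [hm, otherFactor_zero_right]
  · exact Nat.choose_eq_zero_of_lt (by lia)

lemma composition_length_pos {k : ℕ} (hk : k ≠ 0) (m : Composition k) : 0 < m.length :=
  m.length_pos_of_pos (Nat.pos_of_ne_zero hk)

/-- The factor of the `t`-th smallest part when the `i`-th smallest part occurs `c i` times. -/
def indexFactor {d : ℕ} (c : Fin d → ℕ) (t : Fin d) (m : ℕ) : ℕ :=
  if (t : ℕ) = 0 then smallestFactor (c t) m else otherFactor (c t) m

section IndexFactor

variable {k d : ℕ} {m : Composition k} {j : Fin m.length → Fin d}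

lemma prod_indexFactor_spread_eq_zero (c : Fin d → ℕ) (hd : 0 < d) (hj : ∀ i, (j i : ℕ) ≠ 0) :
    ∏ t, indexFactor c t (spread m j t) = 0 := by
  refine prod_eq_zero (mem_univ ⟨0, hd⟩) ?_
  rw [indexFactor, if_pos rfl, spread_eq_zero fun i hi => hj i (congrArg Fin.val hi),
    smallestFactor_zero_right]

lemma prod_indexFactor_spread (c : Fin d → ℕ) (hk : k ≠ 0) (hj : StrictMono j)
    (hj₀ : ∀ i : Fin m.length, (i : ℕ) = 0 → (j i : ℕ) = 0) :
    ∏ t, indexFactor c t (spread m j t) = ∏ i : Fin m.length,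
      if (i : ℕ) = 0 then (c (j i) + m.blocksFun i - 1).choose (2 * m.blocksFun i - 1)
      else (c (j i) + m.blocksFun i).choose (2 * m.blocksFun i) := by
  set i₀ : Fin m.length := ⟨0, composition_length_pos hk m⟩
  rw [prod_spread hj]
  · refine prod_congr rfl fun i _ => ?_
    by_cases hi : (i : ℕ) = 0
    · rw [if_pos hi, indexFactor, if_pos (hj₀ i hi),
        smallestFactor_of_ne_zero _ (Nat.one_le_iff_ne_zero.1 (m.one_le_blocksFun i))]
    · have hlt : j i₀ < j i := hj (Fin.lt_def.2 (Nat.pos_of_ne_zero hi))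
      rw [if_neg hi, indexFactor, if_neg (Nat.ne_zero_of_lt (Fin.lt_def.1 hlt)), otherFactor]
  · intro t ht
    have ht₀ : (t : ℕ) ≠ 0 := fun h => ht i₀ (Fin.ext ((hj₀ i₀ rfl).trans h.symm))
    rw [indexFactor, if_neg ht₀, otherFactor_zero_right]

end IndexFactor

variable {k n : ℕ} (π : n.Partition)

lemma weight_eq_coeff_prod_indexFactor (hk : k ≠ 0) (hπ : 0 < π.parts.toFinset.card) :
    weight k π = coeff k (∏ t, mk (indexFactor (freq π) t)) := by
  rw [← sum_composition_prod_spread, weight]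
  refine sum_congr rfl fun m _ => sum_subset_zero_on_sdiff ?_ ?_ ?_
  · exact fun j hj => mem_filter.2 ⟨mem_univ j, fun a b => (mem_filter.1 hj).2.1 a b⟩
  · intro j hj
    simp only [mem_sdiff, mem_filter, mem_univ, true_and, not_and] at hj
    obtain ⟨hmono, hstart⟩ := hj
    refine prod_indexFactor_spread_eq_zero _ hπ fun i hi => ?_
    refine hstart (fun a b => @hmono a b) fun i' hi' => Nat.le_zero.1 ?_
    have hle : j i' ≤ j i := hmono.monotone (Fin.le_def.2 (hi' ▸ Nat.zero_le _))
    exact hi ▸ Fin.le_def.1 hle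
  · intro j hj
    obtain ⟨hmono, hstart⟩ := (mem_filter.1 hj).2
    exact (prod_indexFactor_spread _ hk (fun a b => hmono a b) hstart).symm

lemma weight_eq_zero (hk : k ≠ 0) (hπ : π.parts.toFinset.card = 0) : weight k π = 0 :=
  sum_eq_zero fun m _ => sum_eq_zero fun j _ =>
    absurd (j ⟨0, composition_length_pos hk m⟩).2 (by lia)

/-- The factor of the part `i` in the weight of a partition with smallest part `a`, when `i`
occurs `c` times and carries the block `m` of the composition, with `m = 0` for no block. It
vanishes when `c > 0` for some `i < a` or `c = 0` for `i = a`, so that the product over all `i`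
detects whether `a` is the smallest part. -/
def partFactor (a i c m : ℕ) : ℕ :=
  if i < a then (if m = 0 ∧ c = 0 then 1 else 0)
  else if i = a then smallestFactor c m
  else otherFactor c m

lemma partFactor_of_lt {a i : ℕ} (h : i < a) (c m : ℕ) :
    partFactor a i c m = if m = 0 ∧ c = 0 then 1 else 0 := if_pos h

lemma partFactor_self (a c m : ℕ) : partFactor a a c m = smallestFactor c m := by
  rw [partFactor, if_neg (lt_irrefl a), if_pos rfl]

lemma partFactor_of_gt {a i : ℕ} (h : a < i) (c m : ℕ) :
    partFactor a i c m = otherFactor c m := by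
  rw [partFactor, if_neg h.not_gt, if_neg h.ne']

lemma mk_partFactor_self_zero (a : ℕ) : mk (partFactor a a 0) = 0 := by
  ext m
  rw [coeff_mk, partFactor_self, smallestFactor_zero_left, map_zero]

lemma mk_partFactor_zero_of_ne {a i : ℕ} (h : i ≠ a) : mk (partFactor a i 0) = 1 := by
  ext m
  rw [coeff_mk, coeff_one]
  rcases h.lt_or_gt with hlt | hgt
  · rw [partFactor_of_lt hlt]
    simp only [and_true]
  · rw [partFactor_of_gt hgt, otherFactor_zero_left]

lemma mk_partFactor_of_lt_of_ne_zero {a i c : ℕ} (h : i < a) (hc : c ≠ 0) :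
    mk (partFactor a i c) = 0 := by
  ext m
  rw [coeff_mk, partFactor_of_lt h, if_neg fun hmc => hc hmc.2, map_zero]

lemma prod_mk_partFactor_eq_zero {s : Finset ℕ} {a b : ℕ} (ha : a ∈ s) (hb : b ∈ s)
    (hbπ : b ∈ π.parts) (h : a ∈ π.parts → b < a) :
    ∏ i ∈ s, mk (partFactor a i (π.parts.count i)) = 0 := by
  by_cases haπ : a ∈ π.parts
  · exact prod_eq_zero hb
      (mk_partFactor_of_lt_of_ne_zero (h haπ) (Multiset.count_pos.2 hbπ).ne')
  · refine prod_eq_zero ha ?_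
    rw [Multiset.count_eq_zero_of_notMem haπ, mk_partFactor_self_zero]

lemma prod_mk_partFactor_min' (hπ : 0 < π.parts.toFinset.card) {s : Finset ℕ}
    (hs : π.parts.toFinset ⊆ s) :
    ∏ i ∈ s, mk (partFactor (π.parts.toFinset.min' (card_pos.1 hπ)) i (π.parts.count i)) =
      ∏ t, mk (indexFactor (freq π) t) := by
  have hmem := min'_mem _ (card_pos.1 hπ)
  have hzero := orderEmbOfFin_zero (s := π.parts.toFinset) rfl hπ
  generalize π.parts.toFinset.min' (card_pos.1 hπ) = a at hmem hzero ⊢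
  rw [← prod_subset hs fun i _ hi => ?_]
  · conv_lhs => rw [← map_orderEmbOfFin_univ π.parts.toFinset rfl, prod_map]
    refine prod_congr rfl fun t _ => congrArg mk (funext fun m => ?_)
    rw [RelEmbedding.coe_toEmbedding, indexFactor, freq, ← hzero]
    by_cases ht : (t : ℕ) = 0
    · obtain rfl : t = ⟨0, hπ⟩ := Fin.ext ht
      rw [partFactor_self, if_pos rfl]
    · rw [partFactor_of_gt, if_neg ht]
      exact (orderEmbOfFin _ rfl).strictMono (Fin.lt_def.2 (Nat.pos_of_ne_zero ht))
  · rw [Multiset.count_eq_zero_of_notMem (Multiset.mem_toFinset.not.1 hi)]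
    exact mk_partFactor_zero_of_ne fun h => hi (h ▸ hmem)

lemma weight_eq_coeff_sum {N : ℕ} (hk : k ≠ 0) (hn : n ≤ N) :
    weight k π =
      ∑ a ∈ Icc 1 N, coeff k (∏ i ∈ Icc 1 N, mk (partFactor a i (π.parts.count i))) := by
  have hsub : π.parts.toFinset ⊆ Icc 1 N := fun i hi => by
    rw [Multiset.mem_toFinset] at hi
    exact mem_Icc.2 ⟨π.parts_pos hi, (π.le_of_mem_parts hi).trans hn⟩
  rcases Nat.eq_zero_or_pos π.parts.toFinset.card with hzero | hpos
  · rw [weight_eq_zero π hk hzero]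
    refine (sum_eq_zero fun a ha => ?_).symm
    have haπ : a ∉ π.parts := by
      rw [← Multiset.mem_toFinset, card_eq_zero.1 hzero]
      exact notMem_empty a
    rw [prod_eq_zero ha, map_zero]
    rw [Multiset.count_eq_zero_of_notMem haπ, mk_partFactor_self_zero]
  · have hmin := min'_mem _ (card_pos.1 hpos)
    rw [weight_eq_coeff_prod_indexFactor π hk hpos, sum_eq_single _ ?_ fun h =>
      absurd (hsub hmin) h, prod_mk_partFactor_min' π hpos hsub]
    intro a ha hne
    rw [prod_mk_partFactor_eq_zero π ha (hsub hmin) (Multiset.mem_toFinset.1 hmin) fun haπ =>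
      (min'_le _ _ (Multiset.mem_toFinset.2 haπ)).lt_of_ne' hne, map_zero]

end Weight

section PartitionGeneratingFunction

/-- The power series `∑ c, g c * X ^ (i * c)`. -/
noncomputable def dilate {R : Type*} [CommSemiring R] (i : ℕ) (g : ℕ → R) : R⟦X⟧ :=
  mk fun e => if i ∣ e then g (e / i) else 0

lemma dilate_eq_expand {R : Type*} [CommRing R] {i : ℕ} (hi : i ≠ 0) (g : ℕ → R) :
    dilate i g = expand i hi (mk g) := by
  ext e
  rw [dilate, coeff_mk, coeff_expand, coeff_mk]

lemma dilate_zero {R : Type*} [CommSemiring R] (i : ℕ) : dilate i (fun _ => (0 : R)) = 0 := by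
  ext e
  rw [dilate, coeff_mk, ite_self, map_zero]

lemma dilate_ite_eq_zero (R : Type*) [CommSemiring R] (i : ℕ) :
    dilate i (fun c => if c = 0 then (1 : R) else 0) = 1 := by
  ext e
  rw [dilate, coeff_mk, coeff_one]
  rcases eq_or_ne e 0 with rfl | he
  · simp
  · rw [if_neg he, ite_eq_right_iff]
    exact fun hdvd => if_neg fun h => he (Nat.eq_zero_of_dvd_of_div_eq_zero hdvd h)

lemma exists_partition_toFinsuppAntidiag_eq {n N : ℕ} {g : ℕ →₀ ℕ}
    (hg : g ∈ (Icc 1 N).finsuppAntidiag n) (hdvd : ∀ i ∈ Icc 1 N, i ∣ g i) :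
    ∃ π : n.Partition, π.toFinsuppAntidiag = g := by
  rw [mem_finsuppAntidiag] at hg
  refine ⟨⟨∑ i ∈ Icc 1 N, Multiset.replicate (g i / i) i, fun {i} hi => ?_, ?_⟩, ?_⟩
  · obtain ⟨j, hj, hij⟩ := Multiset.mem_sum.1 hi
    rw [Multiset.eq_of_mem_replicate hij]
    exact (mem_Icc.1 hj).1
  · rw [← hg.1, Multiset.sum_sum]
    refine sum_congr rfl fun i hi => ?_
    rw [Multiset.sum_replicate, smul_eq_mul, Nat.div_mul_cancel (hdvd i hi)]
  · ext i
    by_cases hi : i ∈ Icc 1 N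
    · simp [Nat.Partition.toFinsuppAntidiag, Multiset.count_sum', Multiset.count_replicate,
        mem_Icc.1 hi, Nat.div_mul_cancel (hdvd i hi)]
    · have hgi : g i = 0 := Finsupp.notMem_support_iff.1 fun h => hi (hg.2 h)
      simp [Nat.Partition.toFinsuppAntidiag, Multiset.count_sum', Multiset.count_replicate, hgi]

lemma coeff_prod_dilate {R : Type*} [CommSemiring R] (f : ℕ → ℕ → R) {n N : ℕ} (hn : n ≤ N) :
    coeff n (∏ i ∈ Icc 1 N, dilate i (f i)) =
      ∑ π : n.Partition, ∏ i ∈ Icc 1 N, f i (π.parts.count i) := by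
  rw [coeff_prod]
  symm
  refine sum_of_injOn Nat.Partition.toFinsuppAntidiag
    (Nat.Partition.toFinsuppAntidiag_injective n).injOn ?_ ?_ ?_
  · exact fun π _ => finsuppAntidiag_mono (Icc_subset_Icc_right hn) _
      π.toFinsuppAntidiag_mem_finsuppAntidiag
  · intro g hg hg'
    by_contra hne
    refine hg' ?_
    obtain ⟨π, hπ⟩ := exists_partition_toFinsuppAntidiag_eq hg fun i hi => by
      by_contra hd
      exact hne (prod_eq_zero hi (by rw [dilate, coeff_mk, if_neg hd]))
    exact ⟨π, mem_coe.2 (mem_univ π), hπ⟩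
  · intro π _
    refine prod_congr rfl fun i hi => ?_
    simp [dilate, Nat.Partition.toFinsuppAntidiag,
      Nat.mul_div_cancel _ (mem_Icc.1 hi).1]

lemma sum_coeff_prod_mk_count {R : Type*} [CommSemiring R] (F : ℕ → ℕ → ℕ → R) (k : ℕ)
    {n N : ℕ} (hn : n ≤ N) :
    ∑ π : n.Partition, coeff k (∏ i ∈ Icc 1 N, mk (F i (π.parts.count i))) =
      coeff n (coeff k (∏ i ∈ Icc 1 N, mk fun m => dilate i fun c => F i c m)) := by
  simp only [coeff_prod _ k, coeff_mk, map_sum]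
  rw [sum_comm]
  exact sum_congr rfl fun g _ => (coeff_prod_dilate (fun i c => F i c (g i)) hn).symm

lemma natCast_coeff_prod_mk {ι : Type*} (R : Type*) [CommSemiring R] (k : ℕ) (s : Finset ι)
    (f : ι → ℕ → ℕ) :
    ((coeff k (∏ i ∈ s, mk (f i)) : ℕ) : R) = coeff k (∏ i ∈ s, mk fun m => (f i m : R)) := by
  classical simp only [coeff_prod, coeff_mk, Nat.cast_sum, Nat.cast_prod]

end PartitionGeneratingFunction

section Evaluation

variable {R : Type*} [CommRing R]

lemma mk_choose_mul_one_sub_pow (j e : ℕ) :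
    (mk fun c => ((c + j).choose (j + e) : R)) * (1 - X) ^ (j + e + 1) = X ^ e := by
  have hshift : (mk fun c => ((c + j).choose (j + e) : R)) =
      X ^ e * PowerSeries.mk fun c => ((j + e + c).choose (j + e) : R) := by
    ext c
    rw [coeff_X_pow_mul', coeff_mk]
    split_ifs with h
    · rw [coeff_mk, show j + e + (c - e) = c + j by lia]
    · rw [Nat.choose_eq_zero_of_lt (by lia), Nat.cast_zero]
  rw [hshift, mul_assoc, mk_add_choose_mul_one_sub_pow_eq_one, mul_one]

lemma dilate_choose {i : ℕ} (hi : i ≠ 0) (j e : ℕ) :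
    dilate i (fun c => ((c + j).choose (j + e) : R)) =
      X ^ (i * e) * invOneSub X i ^ (j + e + 1) := by
  have h := congrArg (expand i hi) (mk_choose_mul_one_sub_pow (R := R) j e)
  simp only [map_mul, map_pow, map_sub, map_one, expand_X, ← dilate_eq_expand, ← pow_mul] at h
  rw [← h, mul_assoc, ← mul_pow, mul_comm (1 - X ^ i), (isQBase_X R).invOneSub_mul hi, one_pow,
    mul_one]

lemma dilate_otherFactor {i : ℕ} (hi : i ≠ 0) (m : ℕ) :
    dilate i (fun c => (otherFactor c m : R)) = invOneSub X i * lambert X i ^ m := by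
  simp only [otherFactor, two_mul]
  rw [dilate_choose hi, lambert]
  ring

lemma dilate_smallestFactor_succ {i : ℕ} (hi : i ≠ 0) (m : ℕ) :
    dilate i (fun c => (smallestFactor c (m + 1) : R)) = lambert X i ^ (m + 1) := by
  have h (c : ℕ) : smallestFactor c (m + 1) = (c + m).choose (m + (m + 1)) := by
    rw [smallestFactor_of_ne_zero c m.succ_ne_zero]
    congr 1
    lia
  simp only [h]
  rw [dilate_choose hi, lambert]
  ring

lemma mk_dilate_partFactor_of_lt {a i : ℕ} (h : i < a) :
    (mk fun m => dilate i fun c => (partFactor a i c m : R)) = 1 := by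
  ext1 m
  simp only [coeff_mk, coeff_one, partFactor_of_lt h]
  rcases m with - | m
  · simp only [true_and, Nat.cast_ite, Nat.cast_one, Nat.cast_zero, if_true, dilate_ite_eq_zero]
  · simp only [Nat.succ_ne_zero, false_and, if_false, Nat.cast_zero, dilate_zero]

lemma mk_dilate_partFactor_self {a : ℕ} (ha : a ≠ 0) :
    (mk fun m => dilate a fun c => (partFactor a a c m : R)) =
      X * (C (lambert X a) * geom (lambert X a)) := by
  ext1 m
  simp only [coeff_mk, partFactor_self]
  rcases m with - | m
  · simp only [smallestFactor_zero_right, Nat.cast_zero, coeff_zero_X_mul, dilate_zero]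
  · rw [dilate_smallestFactor_succ ha, coeff_succ_X_mul, coeff_C_mul, coeff_geom, pow_succ']

lemma mk_dilate_partFactor_of_gt {a i : ℕ} (h : a < i) :
    (mk fun m => dilate i fun c => (partFactor a i c m : R)) =
      C (invOneSub X i) * geom (lambert X i) := by
  ext1 m
  simp only [coeff_mk, partFactor_of_gt h, coeff_C_mul, coeff_geom]
  exact dilate_otherFactor (by lia) m

lemma prod_Ioc_invOneSub {a N : ℕ} (ha : a ≤ N) :
    ∏ i ∈ Ioc a N, invOneSub (X : R⟦X⟧) i = partsProd R N * qPoch X X a := by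
  have hsplit : partsProd R N = partsProd R a * ∏ i ∈ Ioc a N, invOneSub (X : R⟦X⟧) i :=
    (prod_Ioc_consecutive _ a.zero_le ha).symm
  rw [hsplit]
  linear_combination (-∏ i ∈ Ioc a N, invOneSub (X : R⟦X⟧) i) * partsProd_mul_qPoch (R := R) a

lemma prod_mk_dilate_partFactor {a N : ℕ} (ha : a ∈ Icc 1 N) :
    ∏ i ∈ Icc 1 N, mk (fun m => dilate i fun c => (partFactor a i c m : R)) =
      X * (C (partsProd R N * (qPoch X X a * lambert X a)) *
        ∏ i ∈ Icc a N, geom (lambert X i)) := by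
  obtain ⟨ha₁, haN⟩ := mem_Icc.1 ha
  have hbelow : ∀ i ∈ Icc 1 N, i ∉ Icc a N →
      mk (fun m => dilate i fun c => (partFactor a i c m : R)) = 1 := fun i hi hi' => by
    simp only [mem_Icc] at hi hi'
    exact mk_dilate_partFactor_of_lt (by lia)
  rw [← prod_subset (Icc_subset_Icc_left ha₁) hbelow,
    ← Ioc_insert_left haN, prod_insert left_notMem_Ioc, prod_insert left_notMem_Ioc,
    mk_dilate_partFactor_self (by lia),
    prod_congr rfl fun i hi => mk_dilate_partFactor_of_gt (mem_Ioc.1 hi).1, prod_mul_distrib,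
    ← map_prod, prod_Ioc_invOneSub haN]
  simp only [map_mul]
  ring

lemma natCast_spt_eq_coeff_sptSeries {k n N : ℕ} (hn : n ≤ N) :
    (spt (k + 1) n : R) = coeff n (sptSeries R N k) := by
  rw [spt, sum_congr rfl fun π _ => weight_eq_coeff_sum π k.succ_ne_zero hn, sum_comm,
    sptSeries, mul_sum, map_sum, Nat.cast_sum]
  refine sum_congr rfl fun a ha => ?_
  simp only [Nat.cast_sum, natCast_coeff_prod_mk]
  rw [sum_coeff_prod_mk_count (fun i c m => (partFactor a i c m : R)) _ hn,
    prod_mk_dilate_partFactor ha, coeff_succ_X_mul, coeff_C_mul, hsymm, mul_assoc]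

end Evaluation

end HigherSpt

theorem mainTheorem10 (n : ℕ) : HigherSpt.spt 4 (3 * n) ≡ 0 [MOD 3] := by
  rw [Nat.modEq_zero_iff_dvd, ← ZMod.natCast_eq_zero_iff,
    HigherSpt.natCast_spt_eq_coeff_sptSeries (Nat.le_succ (3 * n))]
  exact HigherSpt.coeff_three_mul_sptSeries_three (Nat.le_add_left 1 _) (Nat.le_succ _)
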